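/- Let $n>0$, let $\mathfrak{S}_n$ be the symmetric group on $[n]=\{1,\dots,n\}$ with products read as composition of maps, so that $(uv)(i)=u(v(i))$, let $S=\{s_1,\dots,s_{n-1}\}$ with $s_i=(i\;\,i{+}1)$, and let $\ell_S$ be the word length with respect to $S$. For $J\subseteq S$ let $\mathfrak{S}_n^J=\{w\in\mathfrak{S}_n : \ell_S(w)<\ell_S(ws)\text{ for all }s\in J\}$ be the parabolic quotient, let $w_\circ^J$ be its longest element, and let $w_\circ=w_\circ^{\emptyset}$. Let $c=s_1s_2\cdots s_{n-1}$ be the linear Coxeter element, write $\mathbf{c}$ for the word $s_1s_2\cdots s_{n-1}$, and let $\mathbf{w_\circ(c)}$ be the $c$-sorting word of $w_\circ$, i.e. the reduced expression for $w_\circ$ that occurs leftmost (in the lexicographically first sequence of positions) as a subword of the infinite word $\mathbf{c}\mathbf{c}\mathbf{c}\cdots$. For a word $Q$ in $S$ and $w\in\mathfrak{S}_n$, the subword complex $\mathrm{SW}(Q,w)$ is the simplicial complex on the positions of $Q$ whose facets are the sets $Q\setminus P$ such that the subword of $Q$ in the positions $P$ is a reduced expression for $w$. Call $i,j\in[n]$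 with $i\le j$ in the same $J$-region if $s_k\in J$ for all $i\le k<j$. A pair $(a,b)$ with $a<b$ is a bump of a set partition $\mathbf{P}$ of $[n]$ if $a,b$ lie in a common part of $\mathbf{P}$ that contains no $x$ with $a<x<b$. The partition $\mathbf{P}$ is $J$-nonnesting if no two distinct elements of the same $J$-region lie in the same part of $\mathbf{P}$, and there are no two bumps $(i_1,i_2)$, $(j_1,j_2)$ of $\mathbf{P}$ with $i_1<j_1<j_2<i_2$. Let $\mathrm{NN}_n^J$ be the set of $J$-nonnesting partitions of $[n]$. Then for every $n>0$ and every $J\subseteq S$, the number of facets of the $(\mathfrak{S}_n^J,c)$-cluster complex $\mathrm{SW}\bigl(\mathbf{c\,w_\circ(c)},\,w_\circ^J\bigr)$ equals $\lvert\mathrm{NN}_n^J\rvert$. -/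

import Mathlib

section Words

/-- The product in `W` of a word in the generators `s b`, `b : B`. -/
def wordProduct {W B : Type*} [Group W] (s : B → W) (ω : List B) : W :=
  (ω.map s).prod

/-- `ω` is a reduced expression for `w`: its product is `w`, and no shorter word has product
`w`. -/
def IsReducedExpression {W B : Type*} [Group W] (s : B → W) (w : W) (ω : List B) : Prop :=
  wordProduct s ω = w ∧ ∀ ω' : List B, wordProduct s ω' = w → ω.length ≤ ω'.length

/-- The length `ℓ_S(w)`: the least number of letters of a word with product `w`. -/
noncomputable def wordLength {W B : Type*} [Group W] (s : B → W) (w : W) : ℕ :=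
  sInf {k | ∃ ω : List B, wordProduct s ω = w ∧ ω.length = k}

/-- The parabolic quotient `W^J`, the set of all `w` with `ℓ_S(w) < ℓ_S(ws)` for all `s ∈ J`. -/
def parabolicQuotient {W B : Type*} [Group W] (s : B → W) (J : Set B) : Set W :=
  {w | ∀ j ∈ J, wordLength s w < wordLength s (w * s j)}

/-- The longest element `w_∘^J` of the parabolic quotient `W^J` (for a finite Coxeter group it
exists and is unique). For `J = ∅` this is the longest element `w_∘` of `W`. -/
noncomputable def longestElement {W B : Type*} [Group W] (s : B → W) (J : Set B) : W :=
  Classical.epsilon fun w =>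
    w ∈ parabolicQuotient s J ∧
      ∀ u ∈ parabolicQuotient s J, wordLength s u ≤ wordLength s w

/-- The word `ω` is the subword of the infinite word `c^∞ = c c c ⋯` in the positions
`p₀ < p₁ < ⋯` listed in `p`; the letter of `c^∞` in position `i` is the letter of `c` in
position `i mod |c|` (there is no such letter if `c` is empty). -/
def OccursAt {B : Type*} (c : List B) (p : List ℕ) (ω : List B) : Prop :=
  p.Pairwise (· < ·) ∧ p.map (fun i => getElem? c (i % c.length)) = ω.map some

/-- `ω` is the `c`-sorting word of `w`: the reduced expression for `w` that appears leftmost in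
`c^∞`, that is, in the lexicographically smallest list of positions. -/
def IsSortingWord {W B : Type*} [Group W] (s : B → W) (c : List B) (w : W) (ω : List B) : Prop :=
  IsReducedExpression s w ω ∧ ∃ p : List ℕ, OccursAt c p ω ∧
    ∀ (ω' : List B) (p' : List ℕ), IsReducedExpression s w ω' → OccursAt c p' ω' → p ≤ p'

theorem IsSortingWord.unique {W B : Type*} [Group W] {s : B → W} {c : List B} {w : W}
    {ω ω' : List B} (h : IsSortingWord s c w ω) (h' : IsSortingWord s c w ω') : ω = ω' := by
  obtain ⟨hr, p, hp, hmin⟩ := h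
  obtain ⟨hr', p', hp', hmin'⟩ := h'
  have hpp : p = p' := le_antisymm (hmin _ _ hr' hp') (hmin' _ _ hr hp)
  subst hpp
  exact List.map_injective_iff.2 (Option.some_injective B) (hp.2.symm.trans hp'.2)

theorem exists_isReducedExpression {W B : Type*} [Group W] (s : B → W) (w : W)
    (hw : ∃ ω, wordProduct s ω = w) : ∃ ω, IsReducedExpression s w ω := by
  classical
  have h : ∃ k, ∃ ω : List B, wordProduct s ω = w ∧ ω.length = k := by
    obtain ⟨ω, hω⟩ := hw
    exact ⟨_, ω, hω, rfl⟩
  obtain ⟨ω, hω, hk⟩ := Nat.find_spec h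
  exact ⟨ω, hω, fun ω' hω' => hk ▸ Nat.find_min' h ⟨ω', hω', rfl⟩⟩

theorem exists_occursAt {B : Type*} (c : List B) (hc : ∀ b, b ∈ c) (ω : List B) (N : ℕ) :
    ∃ p, OccursAt c p ω ∧ ∀ i ∈ p, N ≤ i := by
  induction ω generalizing N with
  | nil => exact ⟨[], ⟨List.Pairwise.nil, rfl⟩, by simp⟩
  | cons b ω ih =>
    obtain ⟨k, hk, rfl⟩ := List.getElem_of_mem (hc b)
    obtain ⟨p, ⟨hp, hp'⟩, hN⟩ := ih (k + c.length * N + 1)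
    have hmod : (k + c.length * N) % c.length = k := by
      rw [Nat.add_mul_mod_self_left, Nat.mod_eq_of_lt hk]
    have hle : N ≤ c.length * N := Nat.le_mul_of_pos_left N (by omega)
    refine ⟨(k + c.length * N) :: p, ⟨List.pairwise_cons.2 ⟨fun i hi => ?_, hp⟩, ?_⟩, ?_⟩
    · have := hN i hi
      omega
    · rw [List.map_cons, List.map_cons, hp', hmod, List.getElem?_eq_getElem hk]
    · intro i hi
      rcases List.mem_cons.1 hi with rfl | hi
      · omega
      · have := hN i hi
        omega

theorem exists_least_list (k : ℕ) (A : Set (List ℕ)) (hA : A.Nonempty)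
    (hk : ∀ p ∈ A, p.length = k) : ∃ p ∈ A, ∀ p' ∈ A, p ≤ p' := by
  classical
  induction k generalizing A with
  | zero =>
    obtain ⟨p, hp⟩ := hA
    refine ⟨p, hp, fun p' hp' => ?_⟩
    rw [List.length_eq_zero_iff.1 (hk p hp), List.length_eq_zero_iff.1 (hk p' hp')]
  | succ k ih =>
    have hex : ∃ a : ℕ, ∃ t, a :: t ∈ A := by
      obtain ⟨p, hp⟩ := hA
      cases p with
      | nil => simpa using hk _ hp
      | cons a t => exact ⟨a, t, hp⟩
    obtain ⟨q, hq, hmin⟩ := ih {t | Nat.find hex :: t ∈ A} (Nat.find_spec hex)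
      (fun t ht => by simpa using hk _ ht)
    refine ⟨_, hq, fun p' hp' => ?_⟩
    cases p' with
    | nil => simpa using hk _ hp'
    | cons a t =>
      rcases (Nat.find_min' hex ⟨t, hp'⟩).lt_or_eq with h | h
      · exact le_of_lt (List.Lex.rel h)
      · subst h
        exact List.cons_le_cons _ (hmin t hp')

/-- The `c`-sorting word exists if `c` contains every letter and `w` is a product of letters. -/
theorem exists_isSortingWord {W B : Type*} [Group W] (s : B → W) (c : List B) (hc : ∀ b, b ∈ c)
    (w : W) (hw : ∃ ω, wordProduct s ω = w) : ∃ ω, IsSortingWord s c w ω := by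
  obtain ⟨ω₀, h₀⟩ := exists_isReducedExpression s w hw
  obtain ⟨p₀, hp₀, -⟩ := exists_occursAt c hc ω₀ 0
  obtain ⟨p, ⟨ω, hω, hp⟩, hmin⟩ := exists_least_list ω₀.length
    {p | ∃ ω, IsReducedExpression s w ω ∧ OccursAt c p ω} ⟨p₀, ω₀, h₀, hp₀⟩ (by
      rintro p ⟨ω, hω, hp⟩
      have h1 := congrArg List.length hp.2
      rw [List.length_map, List.length_map] at h1
      rw [h1]
      exact le_antisymm (hω.2 _ h₀.1) (h₀.2 _ hω.1))
  exact ⟨ω, hω, p, hp, fun ω' p' h h' => hmin p' ⟨ω', h, h'⟩⟩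

/-- The `c`-sorting word `w(c)` of `w`. -/
noncomputable def sortingWord {W B : Type*} [Group W] (s : B → W) (c : List B) (w : W) : List B :=
  Classical.epsilon (IsSortingWord s c w)

end Words

section SubwordComplex

/-- The word left over from `Q` when the letters in the positions `F` are removed. -/
def removePositions {B : Type*} (Q : List B) (F : Finset (Fin Q.length)) : List B :=
  ((List.finRange Q.length).filter (fun i => i ∉ F)).map Q.get

/-- The faces of the subword complex `SW(Q, w)`, a simplicial complex on the positions of `Q`:
the sets of positions contained in some `Q - P`, where `P` is a subword of `Q` (given by its
positions) that is a reduced expression for `w`. -/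
def subwordComplex {W B : Type*} [Group W] (s : B → W) (Q : List B) (w : W) :
    Set (Finset (Fin Q.length)) :=
  {F | ∃ G, F ⊆ G ∧ IsReducedExpression s w (removePositions Q G)}

/-- The facets of the subword complex: its maximal faces. -/
def subwordComplexFacets {W B : Type*} [Group W] (s : B → W) (Q : List B) (w : W) :
    Set (Finset (Fin Q.length)) :=
  {F | Maximal (· ∈ subwordComplex s Q w) F}

theorem length_removePositions {B : Type*} (Q : List B) (F : Finset (Fin Q.length)) :
    (removePositions Q F).length = Q.length - F.card := by
  have h : ((List.finRange Q.length).filter (fun i => i ∉ F)).toFinset = Fᶜ := by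
    ext i; simp
  have hn : ((List.finRange Q.length).filter (fun i => i ∉ F)).Nodup :=
    (List.nodup_finRange _).filter _
  rw [removePositions, List.length_map, ← List.toFinset_card_of_nodup hn, h, Finset.card_compl,
    Fintype.card_fin]

/-- The facets are exactly the sets `Q - P` with `P` a reduced expression for `w`. -/
theorem mem_subwordComplexFacets {W B : Type*} [Group W] (s : B → W) (Q : List B) (w : W)
    (F : Finset (Fin Q.length)) :
    F ∈ subwordComplexFacets s Q w ↔ IsReducedExpression s w (removePositions Q F) := by
  constructor
  · rintro ⟨⟨G, hFG, hG⟩, hmax⟩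
    have : F = G := le_antisymm hFG (hmax ⟨G, subset_rfl, hG⟩ hFG)
    rwa [this]
  · intro hF
    refine ⟨⟨F, subset_rfl, hF⟩, ?_⟩
    rintro G ⟨H, hGH, hH⟩ hFG
    have h1 := hF.2 _ hH.1
    have h2 := hH.2 _ hF.1
    rw [length_removePositions, length_removePositions] at h1 h2
    have h3 := Finset.card_le_univ F
    have h4 := Finset.card_le_univ H
    rw [Fintype.card_fin] at h3 h4
    have : F = H := Finset.eq_of_subset_of_card_le (Finset.Subset.trans hFG hGH) (by omega)
    rw [this]
    exact hGH

/-- The facets of the `(W^J, c)`-cluster complex `SW(c w_∘(c), w_∘^J)`, where the Coxeter element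
is given by its reduced expression `c`. -/
noncomputable def clusterComplexFacets {W B : Type*} [Group W] (s : B → W) (c : List B)
    (J : Set B) : Set (Finset (Fin (c ++ sortingWord s c (longestElement s ∅)).length)) :=
  subwordComplexFacets s (c ++ sortingWord s c (longestElement s ∅)) (longestElement s J)

end SubwordComplex

section SymmetricGroup

/-- The adjacent transpositions of the symmetric group on `Fin n`. As `Fin n` starts at `0`,
`adjacentTransposition n i` exchanges `i` and `i + 1`, for `i = 0, …, n - 2`. -/
def adjacentTransposition (n : ℕ) (i : Fin (n - 1)) : Equiv.Perm (Fin n) :=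
  Equiv.swap ⟨i, by omega⟩ ⟨i + 1, by omega⟩

/-- The reduced expression `s₁ s₂ ⋯ s_{n-1}` of the linear Coxeter element. -/
def linearCoxeterWord (n : ℕ) : List (Fin (n - 1)) :=
  List.finRange (n - 1)

/-- `i` and `j` lie in the same `J`-region: no adjacent transposition `s_k ∉ J` separates them.
The `J`-regions are the intervals into which the positions are cut between `k` and `k + 1` for
all `s_k ∉ J`. -/
def SameRegion {n : ℕ} (J : Set (Fin (n - 1))) (i j : Fin n) : Prop :=
  ∀ k : Fin (n - 1), min i.val j.val ≤ k.val → k.val < max i.val j.val → k ∈ J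

/-- `(a, b)` is a bump of the set partition `P`: `a < b` are consecutive elements of a part. -/
def IsBump {n : ℕ} (P : Finpartition (Finset.univ : Finset (Fin n))) (a b : Fin n) : Prop :=
  a < b ∧ ∃ B ∈ P.parts, a ∈ B ∧ b ∈ B ∧ ∀ x ∈ B, ¬(a < x ∧ x < b)

/-- The set `NN_n^J` of `J`-nonnesting partitions: distinct elements of a `J`-region lie in
different parts, and no bump is nested in another one. -/
def nonnestingPartitions {n : ℕ} (J : Set (Fin (n - 1))) :
    Set (Finpartition (Finset.univ : Finset (Fin n))) :=
  {P | (∀ i j : Fin n, i ≠ j → SameRegion J i j → ¬∃ B ∈ P.parts, i ∈ B ∧ j ∈ B) ∧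
    ∀ i₁ i₂ j₁ j₂ : Fin n, IsBump P i₁ i₂ → IsBump P j₁ j₂ → ¬(i₁ < j₁ ∧ j₁ < j₂ ∧ j₂ < i₂)}

end SymmetricGroup

/-!
Both numbers count the chains `μ_0 ≤ μ_1 ≤ ⋯ ≤ μ_{n-1}` of natural numbers with `μ_k ≤ a_k`, where
`a_k` is the number of points that precede the `J`-region of `k` (`regionStart`). Points and letters
are numbered from `0`.

The bumps of a nonnesting partition form an antichain in the poset of intervals whose ends lie in
distinct regions. The order filter that they generate is described by its rows, which form such a
chain, and the bumps are recovered as the jumps of the chain (`isBump_iff_isJump`,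
`exists_nonnestingPartition_bumpHeight_eq`).

For the facets, let `C_k` be the row `s_0 s_1 ⋯ s_{k-1}`. The sorting word of the longest
permutation is the staircase `C_{n-1} C_{n-2} ⋯ C_1` (`isSortingWord_stairWord`), so the facets are
the reduced subwords for `w = w_∘^J` of `C_{n-1}` followed by this staircase. Their number is the
coefficient of `w` in a product of factors `1 + u_i`, where the `u_i` satisfy the nilCoxeter
relations (`ncard_isReducedExpression_removePositions`). Now give each row a weight, replacing
`1 + u_i` by `1 + x u_i`. By the Yang–Baxter equation, rows of equal length commute, and hence

  `(x - y) C_k(x) C_k(y) = x C_k(x) C_{k-1}(y) - y C_k(y) C_{k-1}(x)`,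

that is, doubling a row of a staircase amounts to an isobaric divided difference in the weights
(`IsNilCoxeter.sub_smul_nilRow_mul_nilRow`). The staircase has a single reduced subword for `w`,
because `w` is a dominant permutation; it contributes a monomial with exponents `a_k`
(`nilStair_apply_isRegionReversingUpTo`). An isobaric divided difference turns `x^p y^q` with
`q ≤ p` into the sum of the monomials `x^m y^{p+q-m}` for `q ≤ m ≤ p`. Applying these operators one
after the other therefore gives a sum of monomials indexed by the chains
(`functional_nilRow_mul_nilStair`), which is then specialized at weights equal to `1`. Division by
`x - y` requires distinct weights, so the weights are taken in a polynomial ring first.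
-/

/-! ### The nilCoxeter relations -/

/-- The elements `u 0, u 1, …` of a ring satisfy the relations of the nilCoxeter algebra of the
infinite symmetric group. -/
structure IsNilCoxeter {A : Type*} [Ring A] (u : ℕ → A) : Prop where
  sq : ∀ i, u i * u i = 0
  comm : ∀ i j, i + 1 < j → u i * u j = u j * u i
  braid : ∀ i, u i * u (i + 1) * u i = u (i + 1) * u i * u (i + 1)

section NilCoxeter

variable {R A : Type*} [CommRing R] [Ring A] [Algebra R A]

/-- The factor `h_i(x) = 1 + x u_i` contributed by the letter `i` of weight `x`. -/
def nilFactor (u : ℕ → A) (x : R) (i : ℕ) : A := 1 + x • u i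

/-- The row `h_0(x) h_1(x) ⋯ h_{k-1}(x)`. -/
def nilRow (u : ℕ → A) (k : ℕ) (x : R) : A := ((List.range k).map (nilFactor u x)).prod

/-- The staircase with rows of lengths `k, k - 1, …, 1`, the row of length `i` having the
weight `y i`. -/
def nilStair (u : ℕ → A) (y : ℕ → R) : ℕ → A
  | 0 => 1
  | k + 1 => nilRow u (k + 1) (y (k + 1)) * nilStair u y k

theorem nilRow_zero (u : ℕ → A) (x : R) : nilRow u 0 x = 1 := rfl

theorem nilRow_succ (u : ℕ → A) (k : ℕ) (x : R) :
    nilRow u (k + 1) x = nilRow u k x * nilFactor u x k := by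
  simp [nilRow, List.range_succ]

namespace IsNilCoxeter

variable {u : ℕ → A}

theorem nilFactor_mul (hu : IsNilCoxeter u) (i : ℕ) (s t : R) :
    nilFactor u s i * nilFactor u t i = nilFactor u (s + t) i := by
  simp only [nilFactor, mul_add, add_mul, smul_mul_assoc, mul_smul_comm, hu.sq, mul_one, one_mul]
  module

theorem nilFactor_comm (hu : IsNilCoxeter u) {i j : ℕ} (h : i + 1 < j) (s t : R) :
    nilFactor u s i * nilFactor u t j = nilFactor u t j * nilFactor u s i := by
  simp only [nilFactor, mul_add, add_mul, smul_mul_assoc, mul_smul_comm, hu.comm i j h, mul_one,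
    one_mul]
  module

/-- The Yang–Baxter equation. -/
theorem nilFactor_yangBaxter (hu : IsNilCoxeter u) (i : ℕ) (s t : R) :
    nilFactor u s (i + 1) * nilFactor u (s + t) i * nilFactor u t (i + 1) =
      nilFactor u t i * nilFactor u (s + t) (i + 1) * nilFactor u s i := by
  have h := hu.braid i
  simp only [nilFactor, mul_add, add_mul, smul_mul_assoc, mul_smul_comm, mul_one, one_mul, h,
    hu.sq]
  module

theorem nilRow_comm_nilFactor (hu : IsNilCoxeter u) (k : ℕ) (s t : R) {j : ℕ} (h : k < j) :
    nilRow u k s * nilFactor u t j = nilFactor u t j * nilRow u k s := by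
  induction k with
  | zero => simp [nilRow_zero]
  | succ k ih =>
    rw [nilRow_succ, mul_assoc, hu.nilFactor_comm h, ← mul_assoc, ih (by omega), mul_assoc]

/-- Rows of equal length commute. -/
theorem nilRow_comm (hu : IsNilCoxeter u) (k : ℕ) (x y : R) :
    nilRow u k x * nilRow u k y = nilRow u k y * nilRow u k x := by
  induction k with
  | zero => rfl
  | succ k ih =>
    cases k with
    | zero => simp [nilRow_succ, nilRow_zero, hu.nilFactor_mul, add_comm]
    | succ k =>
      set a : R → A := fun t => nilFactor u t k with ha
      set b : R → A := fun t => nilFactor u t (k + 1) with hb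
      have hP : ∀ s t, nilRow u k s * b t = b t * nilRow u k s :=
        fun s t => hu.nilRow_comm_nilFactor k s t (by omega)
      have haa : ∀ s t, a s * a t = a (s + t) := fun s t => hu.nilFactor_mul k s t
      have hbb : ∀ s t, b s * b t = b (s + t) := fun s t => hu.nilFactor_mul (k + 1) s t
      have ha0 : a 0 = 1 := by simp [ha, nilFactor]
      have hyb : b x * a y * b y = a (y - x) * b y * a x * b x := by
        have h := hu.nilFactor_yangBaxter k x (y - x)
        rw [show x + (y - x) = y by ring] at h
        have h2 : b y = b (y - x) * b x := by rw [hbb]; congr 1; ring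
        calc b x * a y * b y = b x * a y * b (y - x) * b x := by rw [h2]; noncomm_ring
          _ = _ := by rw [show b x * a y * b (y - x) = _ from h]
      rw [nilRow_succ, nilRow_succ] at ih
      have ih' : nilRow u k x * a x * (nilRow u k y * a y) =
          nilRow u k y * a y * (nilRow u k x * a x) := ih
      rw [nilRow_succ u (k + 1) x, nilRow_succ u (k + 1) y, nilRow_succ u k x, nilRow_succ u k y]
      change nilRow u k x * a x * b x * (nilRow u k y * a y * b y) =
        nilRow u k y * a y * b y * (nilRow u k x * a x * b x)
      calc nilRow u k x * a x * b x * (nilRow u k y * a y * b y)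
          = nilRow u k x * a x * (b x * nilRow u k y) * (a y * b y) := by noncomm_ring
        _ = nilRow u k x * a x * nilRow u k y * (b x * a y * b y) := by
            rw [← hP]; noncomm_ring
        _ = nilRow u k x * a x * nilRow u k y * (a (y + -x) * b y * a x * b x) := by
            rw [hyb, sub_eq_add_neg]
        _ = nilRow u k x * a x * (nilRow u k y * a y) * (a (-x) * b y * a x * b x) := by
            rw [← haa]; noncomm_ring
        _ = nilRow u k y * a y * nilRow u k x * (a x * a (-x)) * (b y * a x * b x) := by
            rw [ih']; noncomm_ring
        _ = nilRow u k y * a y * (nilRow u k x * b y) * a x * b x := by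
            rw [haa, add_neg_cancel, ha0]; noncomm_ring
        _ = _ := by rw [hP]; noncomm_ring

/-- Two consecutive rows of equal length are obtained from a staircase by an isobaric divided
difference in their weights. -/
theorem sub_smul_nilRow_mul_nilRow (hu : IsNilCoxeter u) (k : ℕ) (x y : R) :
    (x - y) • (nilRow u (k + 1) x * nilRow u (k + 1) y) =
      x • (nilRow u (k + 1) x * nilRow u k y) - y • (nilRow u (k + 1) y * nilRow u k x) := by
  set E : A := nilRow u (k + 1) x * nilRow u k y with hE
  set F : A := nilRow u (k + 1) y * nilRow u k x with hF
  have h1 : nilRow u (k + 1) x * nilRow u (k + 1) y = E * nilFactor u y k := by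
    rw [nilRow_succ u k y, ← mul_assoc]
  have h2 : nilRow u (k + 1) x * nilRow u (k + 1) y = F * nilFactor u x k := by
    rw [hu.nilRow_comm, nilRow_succ u k x, ← mul_assoc]
  have h0 : nilFactor u (0 : R) k = 1 := by simp [nilFactor]
  -- Multiplying `E h(y) = F h(x)` by `h(-y)` gives `E = F + (x - y) F u`.
  have h3 : E = F * nilFactor u (x - y) k := by
    have h := congrArg (· * nilFactor u (-y) k) (h1.symm.trans h2)
    simpa only [mul_assoc, hu.nilFactor_mul, add_neg_cancel, h0, mul_one,
      ← sub_eq_add_neg] using h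
  have h4 : E * u k = F * u k := by
    rw [h3, nilFactor, mul_assoc, add_mul, smul_mul_assoc, hu.sq]; simp
  have h5 : E = F + (x - y) • (F * u k) := by
    conv_lhs => rw [h3, nilFactor]
    simp [mul_add]
  rw [h1, nilFactor, mul_add, mul_one, mul_smul_comm, h4]
  have h6 : F = E - (x - y) • (F * u k) := by rw [eq_sub_iff_add_eq]; exact h5.symm
  generalize F * u k = G at h6 ⊢
  rw [h6]
  module

end IsNilCoxeter

/-- The weight polynomials `R_j(m)`: the sum over all chains `m_0 ≤ m_1 ≤ ⋯ ≤ m_j = m` with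
`m_i ≤ a i` for `i < j` of the monomials `∏_{i ≤ j} (y i) ^ (a i + m_{i-1} - m_i)`. -/
def chainWeight (a : ℕ → ℕ) (y : ℕ → R) : ℕ → ℕ → R
  | 0, _ => 1
  | j + 1, m => ∑ i ∈ Finset.range (a j + 1) with i ≤ m,
      y (j + 1) ^ (a (j + 1) + i - m) * chainWeight a y j i

theorem sub_mul_sum_pow (x z : R) {a b : ℕ} (h : b ≤ a) :
    (x - z) * ∑ m ∈ Finset.range (a + 1) with b ≤ m, x ^ m * z ^ (a + b - m) =
      x * (x ^ a * z ^ b) - z * (z ^ a * x ^ b) := by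
  have h1 : ∑ m ∈ Finset.range (a + 1) with b ≤ m, x ^ m * z ^ (a + b - m) =
      x ^ b * z ^ b * ∑ i ∈ Finset.range (a - b + 1), x ^ i * z ^ (a - b + 1 - 1 - i) := by
    rw [Finset.mul_sum]
    symm
    refine Finset.sum_bij (fun i _ => b + i) ?_ ?_ ?_ ?_
    · intro i hi
      simp only [Finset.mem_range, Finset.mem_filter] at hi ⊢
      omega
    · intro i _ j _ hij
      simpa using hij
    · intro m hm
      simp only [Finset.mem_range, Finset.mem_filter] at hm
      exact ⟨m - b, by simp only [Finset.mem_range]; omega, by omega⟩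
    · intro i hi
      simp only [Finset.mem_range] at hi
      rw [show a + b - (b + i) = b + (a - b + 1 - 1 - i) by omega, pow_add, pow_add]
      ring
  rw [h1, mul_left_comm, mul_comm (x - z), Commute.geom_sum₂_mul (Commute.all x z)]
  obtain ⟨c, rfl⟩ := Nat.exists_eq_add_of_le h
  rw [show b + c - b + 1 = c + 1 by omega]
  ring

/-- If a linear functional takes monomial values `κ ∏ (y k) ^ (a k)` on all staircases, then its
values on staircases whose longest row is doubled are obtained by iterating isobaric divided
differences, which turn these monomials into sums of monomials. -/
theorem functional_nilRow_mul_nilStair [IsDomain R] {u : ℕ → A} (hu : IsNilCoxeter u)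
    (a : ℕ → ℕ) (ha : Monotone a) (ha0 : a 0 = 0) (j : ℕ) (ψ : A →ₗ[R] R) (κ : R)
    (hψ : ∀ y : ℕ → R, ψ (nilStair u y j) = κ * ∏ k ∈ Finset.range j, y (k + 1) ^ a (k + 1))
    (x : R) (y : ℕ → R) (hy : Function.Injective y) (hx : ∀ i ≤ j, x ≠ y i) :
    ψ (nilRow u j x * nilStair u y j) =
      κ * ∑ m ∈ Finset.range (a j + 1), x ^ m * chainWeight a y j m := by
  induction j generalizing ψ κ x with
  | zero =>
    have h := hψ y
    simp only [Finset.range_zero, Finset.prod_empty] at h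
    rw [nilRow_zero, one_mul, h]
    simp [ha0, chainWeight]
  | succ j ih =>
    set z := y (j + 1) with hz
    have key : ∀ s t : R, (∀ i ≤ j, t ≠ y i) →
        ψ (nilRow u (j + 1) s * (nilRow u j t * nilStair u y j)) =
          κ * s ^ a (j + 1) * ∑ m ∈ Finset.range (a j + 1), t ^ m * chainWeight a y j m := by
      intro s t ht
      refine ih (ψ ∘ₗ LinearMap.mulLeft R (nilRow u (j + 1) s)) (κ * s ^ a (j + 1)) ?_ t ht
      intro y'
      have h := hψ (fun i => if i = j + 1 then s else y' i)
      have hst : ∀ i ≤ j, nilStair u (fun i => if i = j + 1 then s else y' i) i =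
          nilStair u y' i := by
        intro i hi
        induction i with
        | zero => rfl
        | succ i ihi =>
          simp only [nilStair]
          rw [ihi (by omega), if_neg (by omega)]
      rw [nilStair, hst j le_rfl, if_pos rfl, Finset.prod_range_succ, if_pos rfl] at h
      rw [LinearMap.comp_apply, LinearMap.mulLeft_apply, h, mul_assoc, mul_comm (s ^ _)]
      congr 2
      refine Finset.prod_congr rfl fun k hk => ?_
      rw [if_neg (by rw [Finset.mem_range] at hk; omega)]
    have hxz : x - z ≠ 0 := sub_ne_zero.2 (hx _ le_rfl)
    refine mul_left_cancel₀ hxz ?_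
    have h1 := congrArg (fun v => ψ (v * nilStair u y j)) (hu.sub_smul_nilRow_mul_nilRow j x z)
    simp only [sub_mul, smul_mul_assoc, map_sub, map_smul, smul_eq_mul, mul_assoc] at h1
    rw [key x z fun i hi => hy.ne (by omega), key z x fun i hi => hx i (by omega)] at h1
    rw [nilStair, ← hz, sub_mul x z (ψ _), h1]
    calc x * (κ * x ^ a (j + 1) * ∑ m ∈ Finset.range (a j + 1), z ^ m * chainWeight a y j m) -
          z * (κ * z ^ a (j + 1) * ∑ m ∈ Finset.range (a j + 1), x ^ m * chainWeight a y j m)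
        = κ * ∑ m ∈ Finset.range (a j + 1), chainWeight a y j m *
            (x * (x ^ a (j + 1) * z ^ m) - z * (z ^ a (j + 1) * x ^ m)) := by
          simp only [Finset.mul_sum, ← Finset.sum_sub_distrib]
          refine Finset.sum_congr rfl fun m _ => ?_
          ring
      _ = κ * ∑ m ∈ Finset.range (a j + 1), chainWeight a y j m * ((x - z) *
            ∑ i ∈ Finset.range (a (j + 1) + 1) with m ≤ i, x ^ i * z ^ (a (j + 1) + m - i)) := by
          congr 1
          refine Finset.sum_congr rfl fun m hm => ?_
          rw [sub_mul_sum_pow]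
          have := ha (show j ≤ j + 1 by omega)
          rw [Finset.mem_range] at hm
          omega
      _ = (x - z) * (κ * ∑ m ∈ Finset.range (a j + 1),
            ∑ i ∈ Finset.range (a (j + 1) + 1) with m ≤ i,
              x ^ i * (z ^ (a (j + 1) + m - i) * chainWeight a y j m)) := by
          simp only [Finset.mul_sum]
          refine Finset.sum_congr rfl fun m _ => Finset.sum_congr rfl fun i _ => ?_
          ring
      _ = _ := by
          congr 2
          simp only [chainWeight, Finset.mul_sum]
          refine Finset.sum_comm' fun m i => ?_
          simp only [Finset.mem_filter, Finset.mem_range]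
          tauto

end NilCoxeter

/-! ### Inversions and reduced words -/

section Inversions

variable {n : ℕ}

open Equiv

/-- The smaller of the two points exchanged by `adjacentTransposition n i`. -/
abbrev loPoint (i : Fin (n - 1)) : Fin n := ⟨i, by omega⟩

/-- The larger of the two points exchanged by `adjacentTransposition n i`. -/
abbrev hiPoint (i : Fin (n - 1)) : Fin n := ⟨i + 1, by omega⟩

theorem perm_apply_inv (w : Perm (Fin n)) (a : Fin n) : w (w⁻¹ a) = a := w.apply_symm_apply a

theorem perm_inv_apply (w : Perm (Fin n)) (a : Fin n) : w⁻¹ (w a) = a := w.symm_apply_apply a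

/-- The letter `i` is a left descent of `w`: the value `i + 1` stands to the left of `i`. -/
def IsLeftDescent (w : Perm (Fin n)) (i : Fin (n - 1)) : Prop :=
  w⁻¹ (hiPoint i) < w⁻¹ (loPoint i)

theorem adjacentTransposition_mul_self (i : Fin (n - 1)) :
    adjacentTransposition n i * adjacentTransposition n i = 1 := swap_mul_self _ _

theorem adjacentTransposition_inv (i : Fin (n - 1)) :
    (adjacentTransposition n i)⁻¹ = adjacentTransposition n i := swap_inv _ _

theorem adjacentTransposition_mul_cancel_left (i : Fin (n - 1)) (w : Perm (Fin n)) :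
    adjacentTransposition n i * (adjacentTransposition n i * w) = w := by
  rw [← mul_assoc, adjacentTransposition_mul_self, one_mul]

theorem adjacentTransposition_lo (i : Fin (n - 1)) :
    adjacentTransposition n i (loPoint i) = hiPoint i := swap_apply_left _ _

theorem adjacentTransposition_hi (i : Fin (n - 1)) :
    adjacentTransposition n i (hiPoint i) = loPoint i := swap_apply_right _ _

theorem adjacentTransposition_val (i : Fin (n - 1)) (a : Fin n) :
    (adjacentTransposition n i a : ℕ) =
      if (a : ℕ) = i then (i : ℕ) + 1 else if (a : ℕ) = i + 1 then (i : ℕ) else a := by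
  rw [adjacentTransposition, swap_apply_def]
  simp only [Fin.ext_iff]
  split_ifs <;> rfl

theorem lo_lt_hi (i : Fin (n - 1)) : loPoint i < hiPoint i := by
  rw [Fin.lt_def]
  exact Nat.lt_succ_self _

/-- An adjacent transposition of the values preserves the order of any two values but the two that
it exchanges. -/
theorem adjacentTransposition_lt_iff (i : Fin (n - 1)) {a b : Fin n}
    (h1 : ¬(a = loPoint i ∧ b = hiPoint i)) (h2 : ¬(a = hiPoint i ∧ b = loPoint i)) :
    adjacentTransposition n i a < adjacentTransposition n i b ↔ a < b := by
  simp only [Fin.lt_def, adjacentTransposition_val, Fin.ext_iff] at *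
  split_ifs <;> omega

theorem isLeftDescent_mul_iff (w : Perm (Fin n)) (i : Fin (n - 1)) :
    IsLeftDescent (adjacentTransposition n i * w) i ↔ ¬IsLeftDescent w i := by
  have hne : w⁻¹ (loPoint i) ≠ w⁻¹ (hiPoint i) := fun h =>
    (lo_lt_hi i).ne (w⁻¹.injective h)
  simp only [IsLeftDescent, mul_inv_rev, adjacentTransposition_inv, Perm.mul_apply,
    adjacentTransposition_lo, adjacentTransposition_hi, not_lt]
  exact ⟨le_of_lt, fun h => lt_of_le_of_ne h hne⟩

/-- The inversions of `w`: the pairs of positions with decreasing values. -/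
def inversions (w : Perm (Fin n)) : Finset (Fin n × Fin n) :=
  Finset.univ.filter fun x => x.1 < x.2 ∧ w x.2 < w x.1

theorem mem_inversions {w : Perm (Fin n)} {x : Fin n × Fin n} :
    x ∈ inversions w ↔ x.1 < x.2 ∧ w x.2 < w x.1 := by
  simp [inversions]

theorem inversions_mul_of_not_isLeftDescent {w : Perm (Fin n)} {i : Fin (n - 1)}
    (h : ¬IsLeftDescent w i) :
    inversions (adjacentTransposition n i * w) =
      insert (w⁻¹ (loPoint i), w⁻¹ (hiPoint i)) (inversions w) := by
  have hle := not_lt.1 h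
  have hne : w⁻¹ (loPoint i) ≠ w⁻¹ (hiPoint i) := fun h => (lo_lt_hi i).ne (w⁻¹.injective h)
  ext ⟨p, q⟩
  simp only [mem_inversions, Finset.mem_insert, Prod.mk.injEq, Perm.mul_apply]
  by_cases h1 : p = w⁻¹ (loPoint i) ∧ q = w⁻¹ (hiPoint i)
  · obtain ⟨rfl, rfl⟩ := h1
    simp only [perm_apply_inv, adjacentTransposition_lo, adjacentTransposition_hi,
      lo_lt_hi, and_true, true_or, iff_true]
    exact lt_of_le_of_ne hle hne
  · simp only [h1, false_or]
    refine and_congr_right fun hpq => adjacentTransposition_lt_iff i ?_ ?_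
    · rintro ⟨hq, hp⟩
      rw [← Perm.eq_inv_iff_eq] at hq hp
      subst hq hp
      exact (hpq.trans_le hle).false
    · rintro ⟨hq, hp⟩
      rw [← Perm.eq_inv_iff_eq] at hq hp
      exact h1 ⟨hp, hq⟩

theorem card_inversions_mul_of_not_isLeftDescent {w : Perm (Fin n)} {i : Fin (n - 1)}
    (h : ¬IsLeftDescent w i) :
    (inversions (adjacentTransposition n i * w)).card = (inversions w).card + 1 := by
  rw [inversions_mul_of_not_isLeftDescent h, Finset.card_insert_of_notMem]
  rw [mem_inversions]
  simp only [perm_apply_inv]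
  exact fun h' => (lo_lt_hi i).asymm h'.2

theorem card_inversions_mul_of_isLeftDescent {w : Perm (Fin n)} {i : Fin (n - 1)}
    (h : IsLeftDescent w i) :
    (inversions (adjacentTransposition n i * w)).card + 1 = (inversions w).card := by
  have h' : ¬IsLeftDescent (adjacentTransposition n i * w) i :=
    fun h2 => (isLeftDescent_mul_iff w i).1 h2 h
  have := card_inversions_mul_of_not_isLeftDescent h'
  rwa [adjacentTransposition_mul_cancel_left, eq_comm] at this

/-- A permutation is determined by the relative order of its values. -/
theorem perm_eq_of_lt_iff {w v : Perm (Fin n)} (h : ∀ p q, p < q → (w p < w q ↔ v p < v q)) :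
    w = v := by
  have h' : ∀ p q, w p < w q ↔ v p < v q := by
    intro p q
    rcases lt_trichotomy p q with hpq | rfl | hpq
    · exact h p q hpq
    · simp
    · have h1 : ∀ u : Perm (Fin n), u p < u q ↔ ¬u q < u p := fun u =>
        ⟨fun h => h.not_gt, fun h => lt_of_le_of_ne (not_lt.1 h) (u.injective.ne hpq.ne')⟩
      rw [h1 w, h1 v, h q p hpq]
  have hmono : StrictMono (w ∘ ⇑v⁻¹) := fun a b hab => by
    rw [Function.comp_apply, Function.comp_apply, h', perm_apply_inv, perm_apply_inv]
    exact hab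
  have he : w ∘ ⇑v⁻¹ = id := funext fun a =>
    congrArg (fun f : Fin n ≃o Fin n => f a) (Subsingleton.elim
      (hmono.orderIsoOfSurjective _ (w.surjective.comp v⁻¹.surjective)) (OrderIso.refl _))
  ext p
  have h3 : w (v⁻¹ (v p)) = v p := congrFun he (v p)
  rw [perm_inv_apply] at h3
  rw [h3]

theorem perm_eq_of_inversions_eq {w v : Perm (Fin n)} (h : inversions w = inversions v) :
    w = v := by
  refine perm_eq_of_lt_iff fun p q hpq => ?_
  have h1 : ∀ u : Perm (Fin n), u p < u q ↔ (p, q) ∉ inversions u := fun u => by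
    rw [mem_inversions]
    simp only [hpq, true_and, not_lt]
    exact ⟨le_of_lt, fun h => lt_of_le_of_ne h (u.injective.ne hpq.ne)⟩
  rw [h1, h1, h]

theorem inversions_one : inversions (1 : Perm (Fin n)) = ∅ := by
  ext x
  simp only [mem_inversions, Perm.one_apply, Finset.notMem_empty, iff_false, not_and]
  exact fun h => h.asymm

theorem exists_isLeftDescent {w : Perm (Fin n)} (hw : w ≠ 1) : ∃ i, IsLeftDescent w i := by
  by_contra! h
  apply hw
  have hmono : ∀ k : ℕ, ∀ a b : Fin n, (b : ℕ) = a + k + 1 → w⁻¹ a < w⁻¹ b := by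
    have hstep : ∀ a b : Fin n, (b : ℕ) = a + 1 → w⁻¹ a < w⁻¹ b := by
      intro a b hab
      have hb := b.2
      have h1 := h ⟨a, by omega⟩
      have h2 : hiPoint ⟨a, by omega⟩ = b := Fin.ext hab.symm
      rw [IsLeftDescent, h2] at h1
      refine lt_of_le_of_ne (not_lt.1 h1) (w⁻¹.injective.ne ?_)
      intro h3
      rw [Fin.ext_iff] at h3
      omega
    intro k
    induction k with
    | zero => exact hstep
    | succ k ih =>
      intro a b hab
      have hb := b.2
      exact (ih a ⟨a + k + 1, by omega⟩ rfl).trans (hstep _ _ (by rw [hab]; rfl))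
  have : w⁻¹ = 1 := by
    refine perm_eq_of_lt_iff fun p q hpq => ?_
    rw [Fin.lt_def] at hpq
    simp only [Perm.one_apply, Fin.lt_def.2 hpq, iff_true]
    exact hmono (q - p - 1) p q (by omega)
  exact inv_eq_one.1 this

theorem card_inversions_le_length (ω : List (Fin (n - 1))) :
    (inversions (wordProduct (adjacentTransposition n) ω)).card ≤ ω.length := by
  induction ω with
  | nil => simp [wordProduct, inversions_one]
  | cons i ω ih =>
    have hp : wordProduct (adjacentTransposition n) (i :: ω) =
        adjacentTransposition n i * wordProduct (adjacentTransposition n) ω := by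
      simp [wordProduct]
    rw [hp, List.length_cons]
    by_cases h : IsLeftDescent (wordProduct (adjacentTransposition n) ω) i
    · have := card_inversions_mul_of_isLeftDescent h
      omega
    · have := card_inversions_mul_of_not_isLeftDescent h
      omega

theorem exists_word_length_eq_card_inversions (w : Perm (Fin n)) :
    ∃ ω, wordProduct (adjacentTransposition n) ω = w ∧ ω.length = (inversions w).card := by
  generalize hk : (inversions w).card = k
  induction k generalizing w with
  | zero =>
    refine ⟨[], ?_, rfl⟩
    rw [Finset.card_eq_zero, ← inversions_one] at hk
    rw [perm_eq_of_inversions_eq hk]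
    rfl
  | succ k ih =>
    have hw : w ≠ 1 := by
      rintro rfl
      rw [inversions_one] at hk
      simp at hk
    obtain ⟨i, hi⟩ := exists_isLeftDescent hw
    obtain ⟨ω, h1, h2⟩ := ih (adjacentTransposition n i * w) (by
      have := card_inversions_mul_of_isLeftDescent hi
      omega)
    refine ⟨i :: ω, ?_, by simp [h2]⟩
    rw [wordProduct, List.map_cons, List.prod_cons, ← wordProduct, h1,
      adjacentTransposition_mul_cancel_left]

theorem isReducedExpression_iff {w : Perm (Fin n)} {ω : List (Fin (n - 1))} :
    IsReducedExpression (adjacentTransposition n) w ω ↔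
      wordProduct (adjacentTransposition n) ω = w ∧ ω.length = (inversions w).card := by
  constructor
  · rintro ⟨rfl, h⟩
    obtain ⟨ω', h1, h2⟩ := exists_word_length_eq_card_inversions
      (wordProduct (adjacentTransposition n) ω)
    exact ⟨rfl, le_antisymm (h2 ▸ h ω' h1) (card_inversions_le_length ω)⟩
  · rintro ⟨rfl, h⟩
    exact ⟨rfl, fun ω' h' => by rw [h, ← h']; exact card_inversions_le_length ω'⟩

theorem wordLength_eq_card_inversions (w : Perm (Fin n)) :
    wordLength (adjacentTransposition n) w = (inversions w).card := by
  obtain ⟨ω, h1, h2⟩ := exists_word_length_eq_card_inversions w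
  refine le_antisymm (Nat.sInf_le ⟨ω, h1, h2⟩) (le_csInf ⟨_, ω, h1, h2⟩ ?_)
  rintro k ⟨ω', h3, rfl⟩
  rw [← h3]
  exact card_inversions_le_length ω'

theorem isReducedExpression_nil_iff {w : Perm (Fin n)} :
    IsReducedExpression (adjacentTransposition n) w [] ↔ w = 1 := by
  rw [isReducedExpression_iff]
  constructor
  · rintro ⟨rfl, -⟩
    rfl
  · rintro rfl
    exact ⟨rfl, by simp [inversions_one]⟩

/-- The first letter of a reduced word is a left descent of its product. -/
theorem isReducedExpression_cons_iff {w : Perm (Fin n)} {i : Fin (n - 1)}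
    {ω : List (Fin (n - 1))} :
    IsReducedExpression (adjacentTransposition n) w (i :: ω) ↔ IsLeftDescent w i ∧
      IsReducedExpression (adjacentTransposition n) (adjacentTransposition n i * w) ω := by
  simp only [isReducedExpression_iff, wordProduct, List.map_cons, List.prod_cons,
    List.length_cons]
  constructor
  · rintro ⟨rfl, h⟩
    rw [adjacentTransposition_mul_cancel_left]
    have hle := card_inversions_le_length ω
    rw [wordProduct] at hle
    have hd : ¬IsLeftDescent (List.map (adjacentTransposition n) ω).prod i := by
      intro hd
      have := card_inversions_mul_of_isLeftDescent hd
      omega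
    have := card_inversions_mul_of_not_isLeftDescent hd
    exact ⟨(isLeftDescent_mul_iff _ _).2 hd, rfl, by omega⟩
  · rintro ⟨hd, h1, h2⟩
    rw [h1, adjacentTransposition_mul_cancel_left]
    have := card_inversions_mul_of_isLeftDescent hd
    exact ⟨rfl, by omega⟩

theorem wordProduct_reverse (ω : List (Fin (n - 1))) :
    wordProduct (adjacentTransposition n) ω.reverse =
      (wordProduct (adjacentTransposition n) ω)⁻¹ := by
  induction ω with
  | nil => rfl
  | cons i ω ih =>
    simp only [wordProduct, List.reverse_cons, List.map_append, List.map_cons, List.map_nil,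
      List.prod_append, List.prod_cons, List.prod_nil, mul_one, mul_inv_rev,
      adjacentTransposition_inv] at ih ⊢
    rw [ih]

theorem card_inversions_inv (w : Perm (Fin n)) :
    (inversions w⁻¹).card = (inversions w).card := by
  have key : ∀ v : Perm (Fin n), (inversions v⁻¹).card ≤ (inversions v).card := by
    intro v
    obtain ⟨ω, h1, h2⟩ := exists_word_length_eq_card_inversions v
    have := card_inversions_le_length ω.reverse
    rwa [wordProduct_reverse, h1, List.length_reverse, h2] at this
  exact le_antisymm (key w) (by simpa using key w⁻¹)

theorem wordLength_lt_mul_iff (w : Perm (Fin n)) (i : Fin (n - 1)) :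
    wordLength (adjacentTransposition n) w <
        wordLength (adjacentTransposition n) (w * adjacentTransposition n i) ↔
      w (loPoint i) < w (hiPoint i) := by
  rw [wordLength_eq_card_inversions, wordLength_eq_card_inversions, ← card_inversions_inv w,
    ← card_inversions_inv (w * _), mul_inv_rev, adjacentTransposition_inv]
  have hne : w (loPoint i) ≠ w (hiPoint i) := fun h => (lo_lt_hi i).ne (w.injective h)
  by_cases h : IsLeftDescent w⁻¹ i
  · have h1 := card_inversions_mul_of_isLeftDescent h
    rw [IsLeftDescent, inv_inv] at h
    exact iff_of_false (by omega) h.not_gt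
  · have h1 := card_inversions_mul_of_not_isLeftDescent h
    rw [IsLeftDescent, inv_inv, not_lt] at h
    exact iff_of_true (by omega) (lt_of_le_of_ne h hne)

/-- A prefix of a reduced word is reduced, so no letter that follows it is a right descent of its
product. -/
theorem IsReducedExpression.lt_of_append {w : Perm (Fin n)} {ω ω' : List (Fin (n - 1))}
    {i : Fin (n - 1)} (h : IsReducedExpression (adjacentTransposition n) w (ω ++ i :: ω')) :
    wordProduct (adjacentTransposition n) ω (loPoint i) <
      wordProduct (adjacentTransposition n) ω (hiPoint i) := by
  rw [isReducedExpression_iff] at h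
  rw [← wordLength_lt_mul_iff]
  by_contra hcon
  -- Otherwise a shorter word for the prefix gives a shorter word for `w`.
  have h1 : wordProduct (adjacentTransposition n) (ω ++ i :: ω') =
      wordProduct (adjacentTransposition n) ω * adjacentTransposition n i *
        wordProduct (adjacentTransposition n) ω' := by
    simp [wordProduct, mul_assoc]
  obtain ⟨ξ, h2, h3⟩ := exists_word_length_eq_card_inversions
    (wordProduct (adjacentTransposition n) ω * adjacentTransposition n i)
  have h4 := card_inversions_le_length (ξ ++ ω')
  have h5 : wordProduct (adjacentTransposition n) (ξ ++ ω') = w := by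
    rw [← h.1, h1, ← h2]
    simp [wordProduct]
  have h6 := card_inversions_le_length ω
  rw [wordLength_eq_card_inversions, wordLength_eq_card_inversions] at hcon
  have h7 := h.2
  rw [h5] at h4
  simp only [List.length_append, List.length_cons] at h4 h7
  omega

end Inversions

/-! ### The longest elements of the parabolic quotients -/

section Regions

variable {n : ℕ}

open Equiv

open Classical in
/-- The first point of the `J`-region of `k`, which is also the number of points that precede this
region: the largest `i + 1 ≤ k` with `s_i ∉ J`, or `0` if there is none. -/
noncomputable def regionStart (J : Set (Fin (n - 1))) (k : ℕ) : ℕ :=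
  (Finset.univ.filter fun i : Fin (n - 1) => i ∉ J ∧ (i : ℕ) < k).sup fun i => (i : ℕ) + 1

variable {J : Set (Fin (n - 1))}

theorem lt_regionStart_iff {p k : ℕ} :
    p < regionStart J k ↔ ∃ i : Fin (n - 1), i ∉ J ∧ p ≤ i ∧ (i : ℕ) < k := by
  classical
  simp only [regionStart, Finset.lt_sup_iff, Finset.mem_filter, Finset.mem_univ, true_and,
    Nat.lt_succ_iff]
  exact ⟨fun ⟨i, ⟨h1, h2⟩, h3⟩ => ⟨i, h1, h3, h2⟩, fun ⟨i, h1, h3, h2⟩ => ⟨i, ⟨h1, h2⟩, h3⟩⟩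

theorem regionStart_mono (J : Set (Fin (n - 1))) : Monotone (regionStart J) := by
  intro k l hkl
  refine le_of_forall_lt fun p hp => ?_
  obtain ⟨i, h1, h2, h3⟩ := lt_regionStart_iff.1 hp
  exact lt_regionStart_iff.2 ⟨i, h1, h2, h3.trans_le hkl⟩

theorem regionStart_le (k : ℕ) : regionStart J k ≤ k := by
  refine le_of_forall_lt fun p hp => ?_
  obtain ⟨i, h1, h2, h3⟩ := lt_regionStart_iff.1 hp
  exact h2.trans_lt h3

theorem regionStart_zero : regionStart J 0 = 0 := Nat.le_zero.1 (regionStart_le 0)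

theorem regionStart_eq_of_le {p q : ℕ} (hpq : p ≤ q) (h : regionStart J q ≤ p) :
    regionStart J p = regionStart J q := by
  refine le_antisymm (regionStart_mono J hpq) (le_of_forall_lt fun x hx => ?_)
  obtain ⟨i, h1, h2, h3⟩ := lt_regionStart_iff.1 hx
  have h4 : (i : ℕ) < regionStart J q := lt_regionStart_iff.2 ⟨i, h1, le_rfl, h3⟩
  exact lt_regionStart_iff.2 ⟨i, h1, h2, h4.trans_le h⟩

theorem sameRegion_iff {p q : Fin n} (hpq : p ≤ q) :
    SameRegion J p q ↔ regionStart J q ≤ p := by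
  rw [← not_lt, lt_regionStart_iff, SameRegion, min_eq_left (Fin.le_def.1 hpq),
    max_eq_right (Fin.le_def.1 hpq)]
  push Not
  exact ⟨fun h i hi h1 => not_lt.1 fun h2 => hi (h i h1 h2),
    fun h i h1 h2 => by_contra fun hi => (h i hi h1).not_gt h2⟩

/-- The inversions of `w` are the pairs of points of distinct `J`-regions. -/
def IsRegionReversing (J : Set (Fin (n - 1))) (w : Perm (Fin n)) : Prop :=
  ∀ p q : Fin n, p < q → (w q < w p ↔ (p : ℕ) < regionStart J q)

theorem exists_isRegionReversing (J : Set (Fin (n - 1))) : ∃ w, IsRegionReversing J w := by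
  -- Sort the points by their regions in decreasing order, and increasingly within each region.
  set key : Fin n → ℕ := fun p => (n - regionStart J p) * n + p with hkey
  have hinj : Function.Injective key := by
    intro p q hpq
    have h := congrArg (· % n) hpq
    simp only [hkey, Nat.mul_add_mod_self_right, Nat.mod_eq_of_lt p.2,
      Nat.mod_eq_of_lt q.2] at h
    exact Fin.ext h
  have hmono : StrictMono (key ∘ Tuple.sort key) :=
    (Tuple.monotone_sort key).strictMono_of_injective (hinj.comp (Tuple.sort key).injective)
  refine ⟨(Tuple.sort key)⁻¹, fun p q hpq => ?_⟩
  rw [← hmono.lt_iff_lt]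
  simp only [Function.comp_apply, perm_apply_inv, hkey]
  have hp := p.2
  have hq := q.2
  have hle := regionStart_mono J (Fin.le_def.1 hpq.le)
  have hq' := regionStart_le (J := J) (q : ℕ)
  have hp' := regionStart_le (J := J) (p : ℕ)
  rw [Fin.lt_def] at hpq
  by_cases h : (p : ℕ) < regionStart J q
  · refine iff_of_true ?_ h
    have h2 : n - regionStart J q + 1 ≤ n - regionStart J p := by omega
    have h3 := Nat.mul_le_mul_right n h2
    rw [Nat.add_mul, one_mul] at h3
    omega
  · refine iff_of_false ?_ h
    rw [regionStart_eq_of_le hpq.le (not_lt.1 h)]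
    omega

theorem IsRegionReversing.unique {w v : Perm (Fin n)} (hw : IsRegionReversing J w)
    (hv : IsRegionReversing J v) : w = v := by
  refine perm_eq_of_inversions_eq ?_
  ext ⟨p, q⟩
  rw [mem_inversions, mem_inversions]
  exact and_congr_right fun hpq => (hw p q hpq).trans (hv p q hpq).symm

theorem mem_parabolicQuotient_iff {w : Perm (Fin n)} :
    w ∈ parabolicQuotient (adjacentTransposition n) J ↔
      ∀ i ∈ J, w (loPoint i) < w (hiPoint i) := by
  simp only [parabolicQuotient, Set.mem_ofPred_eq, wordLength_lt_mul_iff]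

theorem IsRegionReversing.mem_parabolicQuotient {w : Perm (Fin n)}
    (hw : IsRegionReversing J w) : w ∈ parabolicQuotient (adjacentTransposition n) J := by
  rw [mem_parabolicQuotient_iff]
  intro i hi
  refine lt_of_le_of_ne (not_lt.1 fun h => ?_) (w.injective.ne (lo_lt_hi i).ne)
  obtain ⟨j, h1, h2, h3⟩ := lt_regionStart_iff.1 ((hw _ _ (lo_lt_hi i)).1 h)
  have : j = i := Fin.ext (by simp only at h2 h3; omega)
  exact h1 (this ▸ hi)

theorem lt_of_mem_parabolicQuotient {u : Perm (Fin n)}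
    (hu : u ∈ parabolicQuotient (adjacentTransposition n) J) {p q : Fin n} (hpq : p < q)
    (h : regionStart J q ≤ p) : u p < u q := by
  rw [mem_parabolicQuotient_iff] at hu
  obtain ⟨p, hp⟩ := p
  obtain ⟨q, hq⟩ := q
  simp only [Fin.mk_lt_mk] at hpq h
  induction q with
  | zero => omega
  | succ q ih =>
    have hJ : (⟨q, by omega⟩ : Fin (n - 1)) ∈ J := by
      by_contra hJ
      have := lt_regionStart_iff.2 ⟨(⟨q, by omega⟩ : Fin (n - 1)), hJ, le_rfl, Nat.lt_succ_self q⟩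
      exact (h.trans (Nat.lt_succ_iff.1 hpq)).not_gt this
    have hstep := hu _ hJ
    rcases Nat.lt_succ_iff_lt_or_eq.1 hpq with h1 | rfl
    · exact (ih (by omega) ((regionStart_mono J (Nat.le_succ q)).trans h) h1).trans hstep
    · exact hstep

theorem inversions_subset_of_mem_parabolicQuotient {u w : Perm (Fin n)}
    (hu : u ∈ parabolicQuotient (adjacentTransposition n) J) (hw : IsRegionReversing J w) :
    inversions u ⊆ inversions w := by
  rintro ⟨p, q⟩ h
  rw [mem_inversions] at h ⊢
  refine ⟨h.1, (hw p q h.1).2 (not_le.1 fun h' => ?_)⟩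
  exact (lt_of_mem_parabolicQuotient hu h.1 h').asymm h.2

theorem isRegionReversing_longestElement (J : Set (Fin (n - 1))) :
    IsRegionReversing J (longestElement (adjacentTransposition n) J) := by
  obtain ⟨w, hw⟩ := exists_isRegionReversing J
  obtain ⟨h1, h2⟩ : longestElement (adjacentTransposition n) J ∈
        parabolicQuotient (adjacentTransposition n) J ∧
      ∀ u ∈ parabolicQuotient (adjacentTransposition n) J, wordLength (adjacentTransposition n) u ≤
        wordLength (adjacentTransposition n) (longestElement (adjacentTransposition n) J) :=
    Classical.epsilon_spec (p := fun w =>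
      w ∈ parabolicQuotient (adjacentTransposition n) J ∧
        ∀ u ∈ parabolicQuotient (adjacentTransposition n) J,
          wordLength (adjacentTransposition n) u ≤ wordLength (adjacentTransposition n) w)
    ⟨w, hw.mem_parabolicQuotient, fun u hu => by
      rw [wordLength_eq_card_inversions, wordLength_eq_card_inversions]
      exact Finset.card_le_card (inversions_subset_of_mem_parabolicQuotient hu hw)⟩
  have h3 := h2 w hw.mem_parabolicQuotient
  rw [wordLength_eq_card_inversions, wordLength_eq_card_inversions] at h3
  have h4 := perm_eq_of_inversions_eq (Finset.eq_of_subset_of_card_le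
    (inversions_subset_of_mem_parabolicQuotient h1 hw) h3)
  rwa [h4]

end Regions

/-! ### The sorting word of the longest permutation -/

section SortingWord

open Equiv

/-- The first `k` letters of the linear Coxeter word on `m` letters. -/
def rowWord (m k : ℕ) : List (Fin m) := (List.finRange m).take k

/-- The first `R` rows, of lengths `m, m - 1, …`, of the staircase on `m` letters. -/
def stairWord (m R : ℕ) : List (Fin m) := (List.range R).flatMap fun r => rowWord m (m - r)

/-- The positions that the first `R` rows of the staircase occupy in `c^∞`: the `r`-th row is an
initial segment of the `r`-th copy of `c`. -/
def stairPositions (m R : ℕ) : List ℕ :=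
  (List.range R).flatMap fun r => (List.range (m - r)).map (r * m + ·)

theorem rowWord_map_val {m k : ℕ} (h : k ≤ m) : (rowWord m k).map Fin.val = List.range k := by
  rw [rowWord, List.map_take, List.map_coe_finRange_eq_range, List.take_range, min_eq_left h]

theorem stairWord_succ (m R : ℕ) : stairWord m (R + 1) = stairWord m R ++ rowWord m (m - R) := by
  simp [stairWord, List.range_succ]

theorem stairPositions_succ (m R : ℕ) : stairPositions m (R + 1) =
    stairPositions m R ++ (List.range (m - R)).map (R * m + ·) := by
  simp [stairPositions, List.range_succ]

theorem mem_stairPositions {m R b : ℕ} :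
    b ∈ stairPositions m R ↔ ∃ r < R, ∃ t < m - r, r * m + t = b := by
  simp [stairPositions]

theorem length_stairPositions (m R : ℕ) :
    (stairPositions m R).length = (stairWord m R).length := by
  induction R with
  | zero => rfl
  | succ R ih => simp [stairPositions_succ, stairWord_succ, ih, rowWord]

theorem pairwise_stairPositions (m R : ℕ) : (stairPositions m R).Pairwise (· < ·) := by
  induction R with
  | zero => exact List.Pairwise.nil
  | succ R ih =>
    rw [stairPositions_succ, List.pairwise_append]
    refine ⟨ih, ?_, ?_⟩
    · rw [List.pairwise_map]
      exact List.pairwise_lt_range.imp fun h => by omega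
    · intro a ha b hb
      obtain ⟨r, hr, t, ht, rfl⟩ := mem_stairPositions.1 ha
      obtain ⟨t', -, rfl⟩ := List.mem_map.1 hb
      have : (r + 1) * m ≤ R * m := Nat.mul_le_mul_right m hr
      rw [Nat.add_mul, one_mul] at this
      omega

theorem occursAt_stairWord (m R : ℕ) :
    OccursAt (List.finRange m) (stairPositions m R) (stairWord m R) := by
  refine ⟨pairwise_stairPositions m R, ?_⟩
  induction R with
  | zero => rfl
  | succ R ih =>
    rw [stairPositions_succ, stairWord_succ, List.map_append, List.map_append, ih]
    congr 1
    rw [List.map_map]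
    refine List.ext_getElem (by simp [rowWord]) fun i h1 h2 => ?_
    simp only [List.length_map, List.length_range] at h1
    have hi : i < m := by omega
    simp [rowWord, Nat.mod_eq_of_lt hi, hi]

variable {n : ℕ}

theorem wordProduct_append (ω ω' : List (Fin (n - 1))) :
    wordProduct (adjacentTransposition n) (ω ++ ω') =
      wordProduct (adjacentTransposition n) ω * wordProduct (adjacentTransposition n) ω' := by
  simp [wordProduct]

theorem wordProduct_rowWord_val {k : ℕ} (hk : k ≤ n - 1) (j : Fin n) :
    (wordProduct (adjacentTransposition n) (rowWord (n - 1) k) j : ℕ) =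
      if (j : ℕ) < k then (j : ℕ) + 1 else if (j : ℕ) = k then 0 else j := by
  induction k generalizing j with
  | zero =>
    simp only [rowWord, List.take_zero, wordProduct, List.map_nil, List.prod_nil, Perm.one_apply]
    split_ifs <;> omega
  | succ k ih =>
    have h : rowWord (n - 1) (k + 1) = rowWord (n - 1) k ++ [⟨k, by omega⟩] := by
      rw [rowWord, List.take_succ_eq_append_getElem (by simpa using hk)]
      simp [rowWord]
    rw [h, wordProduct_append, Perm.mul_apply, ih (by omega)]
    simp only [wordProduct, List.map_cons, List.map_nil, List.prod_cons, List.prod_nil, mul_one,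
      adjacentTransposition_val]
    split_ifs <;> omega

theorem wordProduct_stairWord_val {R : ℕ} (hR : R ≤ n - 1) (j : Fin n) :
    (wordProduct (adjacentTransposition n) (stairWord (n - 1) R) j : ℕ) =
      if n - 1 - R < (j : ℕ) then n - 1 - (j : ℕ) else (j : ℕ) + R := by
  induction R generalizing j with
  | zero =>
    simp only [stairWord, List.range_zero, List.flatMap_nil, wordProduct, List.map_nil,
      List.prod_nil, Perm.one_apply]
    split_ifs <;> omega
  | succ R ih =>
    rw [stairWord_succ, wordProduct_append, Perm.mul_apply, ih (by omega),
      wordProduct_rowWord_val (by omega)]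
    have := j.2
    split_ifs <;> omega

theorem wordProduct_stairWord :
    wordProduct (adjacentTransposition n) (stairWord (n - 1) (n - 1)) =
      longestElement (adjacentTransposition n) ∅ := by
  refine IsRegionReversing.unique (J := ∅) (fun p q hpq => ?_) (isRegionReversing_longestElement ∅)
  have hq := q.2
  rw [Fin.lt_def] at hpq ⊢
  rw [wordProduct_stairWord_val le_rfl, wordProduct_stairWord_val le_rfl]
  refine iff_of_true ?_ (lt_regionStart_iff.2 ⟨⟨p, by omega⟩, by simp, le_rfl, hpq⟩)
  split_ifs <;> omega

theorem length_stairWord : (stairWord (n - 1) (n - 1)).length =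
    (inversions (longestElement (adjacentTransposition n) ∅)).card := by
  have h1 : inversions (longestElement (adjacentTransposition n) ∅) =
      Finset.univ.filter fun x : Fin n × Fin n => x.1 < x.2 := by
    ext ⟨p, q⟩
    rw [mem_inversions, Finset.mem_filter]
    simp only [Finset.mem_univ, true_and, and_iff_left_iff_imp]
    intro hpq
    have hq := q.2
    rw [Fin.lt_def] at hpq
    exact (isRegionReversing_longestElement ∅ p q hpq).2
      (lt_regionStart_iff.2 ⟨⟨p, by omega⟩, by simp, le_rfl, hpq⟩)
  have h2 : (Finset.univ.filter fun x : Fin n × Fin n => x.1 < x.2).card =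
      ∑ q : Fin n, (q : ℕ) := by
    rw [Finset.card_filter, Fintype.sum_prod_type_right]
    refine Finset.sum_congr rfl fun q _ => ?_
    rw [← Finset.card_filter, ← Fin.card_Iio q]
    congr 1
    ext p
    simp
  rw [h1, h2, Fin.sum_univ_eq_sum_range (fun q => q) n, ← Finset.sum_range_reflect]
  have h3 : ∀ R, (stairWord (n - 1) R).length = ∑ r ∈ Finset.range R, (n - 1 - r) := by
    intro R
    induction R with
    | zero => rfl
    | succ R ih => simp [stairWord_succ, ih, Finset.sum_range_succ, rowWord]
  rw [h3]
  refine Finset.sum_subset (Finset.range_mono (Nat.sub_le n 1)) fun r _ hr => ?_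
  rw [Finset.mem_range] at hr
  omega

/-- The staircase word is the sorting word: skipping ahead of it in `c^∞` would use a letter that is
a right descent of the product of the rows already used. -/
theorem isSortingWord_stairWord :
    IsSortingWord (adjacentTransposition n) (linearCoxeterWord n)
      (longestElement (adjacentTransposition n) ∅) (stairWord (n - 1) (n - 1)) := by
  have hred := isReducedExpression_iff.2 ⟨wordProduct_stairWord (n := n), length_stairWord⟩
  refine ⟨hred, _, occursAt_stairWord _ _, fun ω' p' hr ho => ?_⟩
  obtain ⟨hs, hm⟩ := ho
  obtain ⟨hs0, hm0⟩ := occursAt_stairWord (n - 1) (n - 1)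
  set p := stairPositions (n - 1) (n - 1) with hp
  set ω := stairWord (n - 1) (n - 1) with hω
  have hlen' : p'.length = ω'.length := by simpa using congrArg List.length hm
  have hlen0 : p.length = ω.length := length_stairPositions _ _
  have hlen : p'.length = p.length := by
    rw [hlen', hlen0, (isReducedExpression_iff.1 hr).2, length_stairWord]
  refine not_lt.1 fun hlt => ?_
  rcases List.lt_iff_exists.1 hlt with h | ⟨i, hi', hi, heq, hb⟩
  · omega
  set b := p'[i] with hbdef
  have hlin : (linearCoxeterWord n).length = n - 1 := by simp [linearCoxeterWord]
  have hsmall : ∀ k (hk : k < p.length), k < i → p[k] < b := fun k hk hki => by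
    rw [← heq k hki]
    exact List.pairwise_iff_getElem.1 hs k i _ hi' hki
  have hbig : ∀ k (hk : k < p.length), i ≤ k → b < p[k] := fun k hk hki => by
    rcases hki.lt_or_eq with h | rfl
    · exact hb.trans (List.pairwise_iff_getElem.1 hs0 i k hi hk h)
    · exact hb
  have hb0 : b ∉ p := by
    intro hmem
    obtain ⟨k, hk, hkb⟩ := List.getElem_of_mem hmem
    rcases lt_or_ge k i with h | h
    · exact (hsmall k hk h).ne hkb
    · exact (hbig k hk h).ne hkb.symm
  have hiω : i < ω'.length := hlen' ▸ hi'
  have hletter : (ω'[i] : ℕ) = b % (n - 1) := by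
    have h1 : (p'.map (fun i => getElem? (linearCoxeterWord n)
        (i % (linearCoxeterWord n).length)))[i]? =
        (ω'.map some)[i]? := by rw [hm]
    simp only [List.getElem?_map, List.getElem?_eq_getElem hi', List.getElem?_eq_getElem hiω,
      Option.map_some, Option.some.injEq, hlin] at h1
    obtain ⟨h2, h3⟩ := List.getElem?_eq_some_iff.1 h1
    rw [← h3]
    simp [linearCoxeterWord, hbdef]
  have hm1 : 0 < n - 1 := (Nat.zero_le _).trans_lt ω'[i].2
  set r := b / (n - 1) with hrdef
  set t := b % (n - 1) with htdef
  have hbrt : r * (n - 1) + t = b := by rw [mul_comm]; exact Nat.div_add_mod b (n - 1)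
  have htlt : t < n - 1 := Nat.mod_lt _ hm1
  have hrlt : r < n - 1 := by
    obtain ⟨r', hr', t', ht', h⟩ := mem_stairPositions.1 (List.getElem_mem hi)
    by_contra hge
    have h1 : (r' + 1) * (n - 1) ≤ r * (n - 1) := Nat.mul_le_mul_right _ (by omega)
    rw [Nat.add_mul, one_mul] at h1
    omega
  have hrt : n - 1 ≤ r + t := by
    by_contra hlt'
    exact hb0 (mem_stairPositions.2 ⟨r, hrlt, t, by omega, hbrt⟩)
  -- The common prefix consists of the first `r + 1` rows.
  have hsplit : ∀ R ≤ n - 1, ∃ l l', p = stairPositions (n - 1) R ++ l ∧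
      ω = stairWord (n - 1) R ++ l' ∧ ∀ x ∈ l, R * (n - 1) ≤ x := by
    intro R hR
    obtain ⟨d, hd⟩ := Nat.exists_eq_add_of_le hR
    rw [hp, hω]
    have : ∀ d, ∃ l l', stairPositions (n - 1) (R + d) = stairPositions (n - 1) R ++ l ∧
        stairWord (n - 1) (R + d) = stairWord (n - 1) R ++ l' ∧
        ∀ x ∈ l, R * (n - 1) ≤ x := by
      intro d
      induction d with
      | zero => exact ⟨[], [], by simp⟩
      | succ d ih =>
        obtain ⟨l, l', h1, h2, h3⟩ := ih
        refine ⟨l ++ _, l' ++ _, by rw [← add_assoc, stairPositions_succ, h1, List.append_assoc],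
          by rw [← add_assoc, stairWord_succ, h2, List.append_assoc], fun x hx => ?_⟩
        rcases List.mem_append.1 hx with hx | hx
        · exact h3 x hx
        · obtain ⟨y, -, rfl⟩ := List.mem_map.1 hx
          have := Nat.mul_le_mul_right (n - 1) (Nat.le_add_right R d)
          omega
    obtain ⟨l, l', h1, h2, h3⟩ := this d
    rw [← hd] at h1 h2
    exact ⟨l, l', h1, h2, h3⟩
  obtain ⟨l, l', hl, hl', hlbig⟩ := hsplit (r + 1) hrlt
  have hlenR := length_stairPositions (n - 1) (r + 1)
  have hiL : i = (stairPositions (n - 1) (r + 1)).length := by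
    rcases lt_trichotomy i (stairPositions (n - 1) (r + 1)).length with h | h | h
    · exfalso
      have h1 : p[i] ∈ stairPositions (n - 1) (r + 1) := by
        have : p[i] = (stairPositions (n - 1) (r + 1) ++ l)[i]'(hl ▸ hi) := by
          simp only [hl]
        rw [this, List.getElem_append_left h]
        exact List.getElem_mem _
      obtain ⟨r', hr', t', ht', h2⟩ := mem_stairPositions.1 h1
      rcases (Nat.lt_succ_iff.1 hr').lt_or_eq with h3 | rfl
      · have h4 : (r' + 1) * (n - 1) ≤ r * (n - 1) := Nat.mul_le_mul_right _ h3
        rw [Nat.add_mul, one_mul] at h4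
        omega
      · omega
    · exact h
    · exfalso
      have hL : (stairPositions (n - 1) (r + 1)).length < p.length := h.trans hi
      have h1 : p[(stairPositions (n - 1) (r + 1)).length] ∈ l := by
        have : p[(stairPositions (n - 1) (r + 1)).length] =
            (stairPositions (n - 1) (r + 1) ++ l)[(stairPositions (n - 1) (r + 1)).length]'(
              hl ▸ hL) := by
          simp only [hl]
        rw [this, List.getElem_append_right le_rfl]
        exact List.getElem_mem _
      have h2 := hlbig _ h1
      have h3 := hsmall _ hL h
      rw [Nat.add_mul, one_mul] at h2
      omega
  have hprefix : ω'.take i = stairWord (n - 1) (r + 1) := by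
    have h1 : (ω'.take i).map some = (ω.take i).map some := by
      rw [List.map_take, List.map_take, ← hm, ← hm0, ← List.map_take, ← List.map_take]
      congr 1
      refine List.ext_getElem (by simp [hlen]) fun k h1 h2 => ?_
      rw [List.getElem_take, List.getElem_take]
      exact heq k (by simp at h1; omega)
    have h2 := List.map_injective_iff.2 (Option.some_injective _) h1
    rw [h2, hl', hiL, hlenR, List.take_left]
  have hω' : ω' = stairWord (n - 1) (r + 1) ++ ω'[i] :: ω'.drop (i + 1) := by
    rw [← hprefix, ← List.drop_eq_getElem_cons, List.take_append_drop]
  rw [hω'] at hr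
  have hfin := hr.lt_of_append
  rw [Fin.lt_def, wordProduct_stairWord_val (by omega),
    wordProduct_stairWord_val (by omega)] at hfin
  simp only [hletter] at hfin
  split_ifs at hfin <;> omega

theorem sortingWord_longestElement :
    sortingWord (adjacentTransposition n) (linearCoxeterWord n)
      (longestElement (adjacentTransposition n) ∅) = stairWord (n - 1) (n - 1) :=
  (Classical.epsilon_spec ⟨_, isSortingWord_stairWord⟩ :
    IsSortingWord (adjacentTransposition n) (linearCoxeterWord n)
      (longestElement (adjacentTransposition n) ∅) _).unique isSortingWord_stairWord

end SortingWord

/-! ### The nilCoxeter operators of the symmetric group -/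

section Operators

open Equiv

variable {n : ℕ} (R : Type*) [CommRing R]

open Classical in
/-- The operator on functions on the symmetric group that is dual to multiplication by `u_k` in the
nilCoxeter algebra. It is zero if there is no letter `k`. -/
noncomputable def nilOp (n k : ℕ) : Module.End R (Perm (Fin n) → R) :=
  if h : k < n - 1 then
    { toFun := fun f w =>
        if IsLeftDescent w ⟨k, h⟩ then f (adjacentTransposition n ⟨k, h⟩ * w) else 0
      map_add' := fun f g => by
        ext w
        simp only [Pi.add_apply]
        split_ifs <;> simp
      map_smul' := fun r f => by
        ext w
        simp only [Pi.smul_apply, RingHom.id_apply]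
        split_ifs <;> simp }
  else 0

variable {R}

open Classical in
theorem nilOp_apply (i : Fin (n - 1)) (f : Perm (Fin n) → R) (w : Perm (Fin n)) :
    nilOp R n i f w =
      if IsLeftDescent w i then f (adjacentTransposition n i * w) else 0 := by
  rw [nilOp, dif_pos i.2]
  rfl

theorem nilOp_apply_of_isLeftDescent {i : Fin (n - 1)} {w : Perm (Fin n)} (h : IsLeftDescent w i)
    (f : Perm (Fin n) → R) : nilOp R n i f w = f (adjacentTransposition n i * w) := by
  rw [nilOp_apply, if_pos h]

theorem nilOp_apply_of_not_isLeftDescent {i : Fin (n - 1)} {w : Perm (Fin n)}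
    (h : ¬IsLeftDescent w i) (f : Perm (Fin n) → R) : nilOp R n i f w = 0 := by
  rw [nilOp_apply, if_neg h]

theorem nilOp_of_le {k : ℕ} (h : n - 1 ≤ k) : nilOp R n k = 0 := by
  rw [nilOp, dif_neg (not_lt.2 h)]

theorem isLeftDescent_mul_iff_apply (w : Perm (Fin n)) (i j : Fin (n - 1)) :
    IsLeftDescent (adjacentTransposition n j * w) i ↔
      w⁻¹ (adjacentTransposition n j (hiPoint i)) <
        w⁻¹ (adjacentTransposition n j (loPoint i)) := by
  simp only [IsLeftDescent, mul_inv_rev, adjacentTransposition_inv, Perm.mul_apply]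

theorem isNilCoxeter_nilOp : IsNilCoxeter (nilOp R n) where
  sq k := by
    rcases lt_or_ge k (n - 1) with h | h
    · lift k to Fin (n - 1) using h
      refine LinearMap.ext fun f => funext fun w => ?_
      rw [Module.End.mul_apply, LinearMap.zero_apply, Pi.zero_apply]
      by_cases h : IsLeftDescent w k
      · rw [nilOp_apply_of_isLeftDescent h, nilOp_apply_of_not_isLeftDescent
          (fun h' => (isLeftDescent_mul_iff w k).1 h' h)]
      · rw [nilOp_apply_of_not_isLeftDescent h]
    · simp [nilOp_of_le h]
  comm k l hkl := by
    rcases lt_or_ge l (n - 1) with h | h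
    · lift k to Fin (n - 1) using by omega
      lift l to Fin (n - 1) using h
      have h1 : adjacentTransposition n k * adjacentTransposition n l =
          adjacentTransposition n l * adjacentTransposition n k := by
        ext a
        simp only [Perm.mul_apply, adjacentTransposition_val]
        split_ifs <;> omega
      have h2 : ∀ a : Fin n, (a : ℕ) = k ∨ (a : ℕ) = k + 1 → adjacentTransposition n l a = a := by
        intro a ha
        refine Fin.ext ?_
        rw [adjacentTransposition_val]
        split_ifs <;> omega
      have h3 : ∀ a : Fin n, (a : ℕ) = l ∨ (a : ℕ) = l + 1 → adjacentTransposition n k a = a := by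
        intro a ha
        refine Fin.ext ?_
        rw [adjacentTransposition_val]
        split_ifs <;> omega
      refine LinearMap.ext fun f => funext fun w => ?_
      have h4 : IsLeftDescent (adjacentTransposition n l * w) k ↔ IsLeftDescent w k := by
        rw [isLeftDescent_mul_iff_apply, h2 _ (Or.inr rfl), h2 _ (Or.inl rfl), IsLeftDescent]
      have h5 : IsLeftDescent (adjacentTransposition n k * w) l ↔ IsLeftDescent w l := by
        rw [isLeftDescent_mul_iff_apply, h3 _ (Or.inr rfl), h3 _ (Or.inl rfl), IsLeftDescent]
      have h6 : adjacentTransposition n k * (adjacentTransposition n l * w) =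
          adjacentTransposition n l * (adjacentTransposition n k * w) := by
        rw [← mul_assoc, h1, mul_assoc]
      by_cases h7 : IsLeftDescent w k <;> by_cases h8 : IsLeftDescent w l <;>
        simp only [Module.End.mul_apply, nilOp_apply_of_isLeftDescent,
          nilOp_apply_of_not_isLeftDescent, h4, h5, h6, h7, h8, not_false_eq_true]
    · simp [nilOp_of_le h]
  braid k := by
    rcases lt_or_ge (k + 1) (n - 1) with h | h
    · obtain ⟨i, rfl⟩ : ∃ i : Fin (n - 1), (i : ℕ) = k := ⟨⟨k, by omega⟩, rfl⟩
      obtain ⟨j, hj⟩ : ∃ j : Fin (n - 1), (j : ℕ) = i + 1 := ⟨⟨i + 1, h⟩, rfl⟩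
      rw [← hj]
      have hji : loPoint j = hiPoint i := Fin.ext hj
      have hic : adjacentTransposition n i (hiPoint j) = hiPoint j := by
        refine Fin.ext ?_
        rw [adjacentTransposition_val]
        simp only
        split_ifs <;> omega
      have hja : adjacentTransposition n j (loPoint i) = loPoint i := by
        refine Fin.ext ?_
        rw [adjacentTransposition_val]
        simp only
        split_ifs <;> omega
      have h1 : adjacentTransposition n i * adjacentTransposition n j *
          adjacentTransposition n i = adjacentTransposition n j * adjacentTransposition n i *
            adjacentTransposition n j := by
        have hsi : adjacentTransposition n i = swap (loPoint i) (hiPoint i) := rfl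
        have hsj : adjacentTransposition n j = swap (hiPoint i) (hiPoint j) := by
          rw [← hji]
          rfl
        have hij : loPoint i ≠ hiPoint i := (lo_lt_hi i).ne
        have hjj : hiPoint j ≠ hiPoint i := by
          rw [← hji]
          exact (lo_lt_hi j).ne'
        have hlj : loPoint i ≠ hiPoint j := by
          simp only [ne_eq, Fin.mk.injEq]
          omega
        rw [hsi, hsj, swap_mul_swap_mul_swap hij hlj, swap_comm (loPoint i) (hiPoint i),
          swap_comm (hiPoint i) (hiPoint j), swap_mul_swap_mul_swap hjj hlj.symm, swap_comm]
      have hi1 := adjacentTransposition_lo i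
      have hi2 := adjacentTransposition_hi i
      have hj1 := adjacentTransposition_lo j
      have hj2 := adjacentTransposition_hi j
      rw [hji] at hj1 hj2
      refine LinearMap.ext fun f => funext fun w => ?_
      -- Both sides vanish unless the values `i`, `i + 1`, `i + 2` occur in decreasing order.
      have e1 : IsLeftDescent w i ↔ w⁻¹ (hiPoint i) < w⁻¹ (loPoint i) := Iff.rfl
      have e2 : IsLeftDescent w j ↔ w⁻¹ (hiPoint j) < w⁻¹ (hiPoint i) := by
        rw [IsLeftDescent, hji]
      have e3 : IsLeftDescent (adjacentTransposition n i * w) j ↔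
          w⁻¹ (hiPoint j) < w⁻¹ (loPoint i) := by
        rw [isLeftDescent_mul_iff_apply, hic, hji, hi2]
      have e4 : IsLeftDescent (adjacentTransposition n j * w) i ↔
          w⁻¹ (hiPoint j) < w⁻¹ (loPoint i) := by
        rw [isLeftDescent_mul_iff_apply, hja, hj1]
      have e5 : IsLeftDescent (adjacentTransposition n j * (adjacentTransposition n i * w)) i ↔
          w⁻¹ (hiPoint j) < w⁻¹ (hiPoint i) := by
        rw [isLeftDescent_mul_iff_apply, hja, hj1, mul_inv_rev, adjacentTransposition_inv,
          Perm.mul_apply, Perm.mul_apply, hic, hi1]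
      have e6 : IsLeftDescent (adjacentTransposition n i * (adjacentTransposition n j * w)) j ↔
          w⁻¹ (hiPoint i) < w⁻¹ (loPoint i) := by
        rw [isLeftDescent_mul_iff_apply, hic, hji, hi2, mul_inv_rev, adjacentTransposition_inv,
          Perm.mul_apply, Perm.mul_apply, hj2, hja]
      have h2 : adjacentTransposition n i * (adjacentTransposition n j *
          (adjacentTransposition n i * w)) = adjacentTransposition n j *
            (adjacentTransposition n i * (adjacentTransposition n j * w)) := by
        simpa only [mul_assoc] using congrArg (· * w) h1
      simp only [Module.End.mul_apply]
      by_cases hba : w⁻¹ (hiPoint i) < w⁻¹ (loPoint i) <;>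
        by_cases hcb : w⁻¹ (hiPoint j) < w⁻¹ (hiPoint i) <;>
        by_cases hca : w⁻¹ (hiPoint j) < w⁻¹ (loPoint i) <;>
        first
        | exact absurd (hcb.trans hba) hca
        | simp only [nilOp_apply_of_isLeftDescent, nilOp_apply_of_not_isLeftDescent, e1, e2, e3,
            e4, e5, e6, hba, hcb, hca, h2, not_false_eq_true]
    · simp [nilOp_of_le h]

theorem nilFactor_nilOp_apply (x : R) (i : Fin (n - 1)) (f : Perm (Fin n) → R)
    (w : Perm (Fin n)) : nilFactor (nilOp R n) x i f w =
      f w + x * nilOp R n i f w := by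
  simp [nilFactor]

/-! ### Counting facets -/

theorem removePositions_cons_map_succ {B : Type*} (q : B) (Q : List B)
    (F : Finset (Fin Q.length)) :
    removePositions (q :: Q) (F.map (Fin.succEmb Q.length)) = q :: removePositions Q F := by
  unfold removePositions
  change ((List.finRange (Q.length + 1)).filter _).map _ = _
  rw [List.finRange_succ, List.filter_cons, List.filter_map]
  simp [Function.comp_def]

theorem removePositions_cons_insert {B : Type*} (q : B) (Q : List B)
    (F : Finset (Fin Q.length)) :
    removePositions (q :: Q) (insert (0 : Fin (Q.length + 1)) (F.map (Fin.succEmb Q.length))) =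
      removePositions Q F := by
  unfold removePositions
  change ((List.finRange (Q.length + 1)).filter _).map _ = _
  rw [List.finRange_succ, List.filter_cons, List.filter_map]
  simp [Function.comp_def]

theorem ncard_removePositions_cons {B : Type*} (q : B) (Q : List B) (P : List B → Prop) :
    {F : Finset (Fin (q :: Q).length) | P (removePositions (q :: Q) F)}.ncard =
      {F : Finset (Fin Q.length) | P (removePositions Q F)}.ncard +
        {F : Finset (Fin Q.length) | P (q :: removePositions Q F)}.ncard := by
  set A : Finset (Fin Q.length) → Finset (Fin (Q.length + 1)) :=
    fun F => insert 0 (F.map (Fin.succEmb Q.length)) with hA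
  set B : Finset (Fin Q.length) → Finset (Fin (Q.length + 1)) :=
    fun F => F.map (Fin.succEmb Q.length) with hB
  have hB0 : ∀ F, (0 : Fin (Q.length + 1)) ∉ B F := fun F => by simp [hB]
  have hBinj : Function.Injective B := Finset.map_injective _
  have hAinj : Function.Injective A := by
    intro F G h
    have h1 := congrArg (fun S => S.erase 0) h
    simp only [hA] at h1
    rw [Finset.erase_insert (hB0 F), Finset.erase_insert (hB0 G)] at h1
    exact hBinj h1
  have hsplit : {F : Finset (Fin (q :: Q).length) | P (removePositions (q :: Q) F)} =
      A '' {F | P (removePositions Q F)} ∪ B '' {F | P (q :: removePositions Q F)} := by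
    ext F
    change Finset (Fin (Q.length + 1)) at F
    constructor
    · intro hF
      have hF' : P (removePositions (q :: Q) F) := hF
      have hpre : (Finset.univ.filter fun i : Fin Q.length => i.succ ∈ F).map
          (Fin.succEmb Q.length) = F.erase 0 := by
        ext i
        refine Fin.cases ?_ (fun i => ?_) i
        · simp
        · simp [Fin.succ_ne_zero]
      by_cases h0 : (0 : Fin (Q.length + 1)) ∈ F
      · refine Or.inl ⟨Finset.univ.filter fun i => i.succ ∈ F, ?_, ?_⟩
        · change P _
          rw [← removePositions_cons_insert q, hpre, Finset.insert_erase h0]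
          exact hF'
        · simp only [hA]
          rw [hpre, Finset.insert_erase h0]
      · refine Or.inr ⟨Finset.univ.filter fun i => i.succ ∈ F, ?_, ?_⟩
        · change P _
          rw [← removePositions_cons_map_succ q, hpre, Finset.erase_eq_of_notMem h0]
          exact hF'
        · simp only [hB]
          rw [hpre, Finset.erase_eq_of_notMem h0]
    · rintro (⟨G, hG, rfl⟩ | ⟨G, hG, rfl⟩)
      · change P (removePositions (q :: Q) (A G))
        simp only [hA]
        rw [removePositions_cons_insert]
        exact hG
      · change P (removePositions (q :: Q) (B G))
        simp only [hB]
        rw [removePositions_cons_map_succ]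
        exact hG
  rw [hsplit, Set.ncard_union_eq _ (Set.toFinite _) (Set.toFinite _),
    Set.ncard_image_of_injective _ hAinj, Set.ncard_image_of_injective _ hBinj]
  rw [Set.disjoint_left]
  rintro _ ⟨F, -, rfl⟩ ⟨G, -, h⟩
  exact hB0 G (h ▸ Finset.mem_insert_self _ _)

/-- The number of subwords of `Q` that are reduced expressions for `w` is the coefficient of `w` in
the product of the factors `1 + u_q` over the letters `q` of `Q`. -/
theorem ncard_isReducedExpression_removePositions (Q : List (Fin (n - 1))) (w : Perm (Fin n)) :
    ({F : Finset (Fin Q.length) | IsReducedExpression (adjacentTransposition n) w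
        (removePositions Q F)}.ncard : ℤ) =
      (Q.map fun q : Fin (n - 1) => nilFactor (nilOp ℤ n) (1 : ℤ) (q : ℕ)).prod
        (Pi.single 1 1) w := by
  classical
  induction Q generalizing w with
  | nil =>
    have h : ∀ F : Finset (Fin ([] : List (Fin (n - 1))).length), removePositions [] F = [] :=
      fun F => rfl
    simp only [h, isReducedExpression_nil_iff, List.map_nil, List.prod_nil, Module.End.one_apply]
    by_cases hw : w = 1
    · subst hw
      simp [Set.ofPred_true]
    · simp [hw]
  | cons q Q ih =>
    rw [ncard_removePositions_cons, List.map_cons, List.prod_cons, Module.End.mul_apply,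
      nilFactor_nilOp_apply, nilOp_apply, ← ih, one_mul]
    simp only [isReducedExpression_cons_iff]
    by_cases h : IsLeftDescent w q
    · simp [h, ih]
    · simp [h]

theorem prod_rowWord {m k : ℕ} (hk : k ≤ m) (u : ℕ → Module.End R (Perm (Fin n) → R)) (x : R) :
    ((rowWord m k).map fun q : Fin m => nilFactor u x (q : ℕ)).prod = nilRow u k x := by
  rw [nilRow, ← rowWord_map_val hk, List.map_map]
  rfl

theorem prod_stairWord {m R' : ℕ} (hR : R' ≤ m) (u : ℕ → Module.End R (Perm (Fin n) → R))
    (x : R) : ((stairWord m R').map fun q : Fin m => nilFactor u x (q : ℕ)).prod *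
      nilStair u (fun _ => x) (m - R') = nilStair u (fun _ => x) m := by
  induction R' with
  | zero => simp [stairWord]
  | succ r ih =>
    obtain ⟨d, hd⟩ := Nat.exists_eq_add_of_le hR
    have h1 : m - r = d + 1 := by omega
    have h2 : m - (r + 1) = d := by omega
    rw [← ih (by omega), stairWord_succ, List.map_append, List.prod_append, mul_assoc,
      prod_rowWord (by omega), h1, h2, nilStair]

theorem ncard_clusterComplexFacets (J : Set (Fin (n - 1))) :
    ((clusterComplexFacets (adjacentTransposition n) (linearCoxeterWord n) J).ncard : ℤ) =
      (nilRow (nilOp ℤ n) (n - 1) (1 : ℤ) * nilStair (nilOp ℤ n) (fun _ => (1 : ℤ)) (n - 1))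
        (Pi.single 1 1) (longestElement (adjacentTransposition n) J) := by
  have h1 := ncard_isReducedExpression_removePositions
    (linearCoxeterWord n ++ sortingWord (adjacentTransposition n) (linearCoxeterWord n)
      (longestElement (adjacentTransposition n) ∅)) (longestElement (adjacentTransposition n) J)
  have h2 : clusterComplexFacets (adjacentTransposition n) (linearCoxeterWord n) J =
      {F | IsReducedExpression (adjacentTransposition n)
        (longestElement (adjacentTransposition n) J) (removePositions _ F)} := by
    ext F
    exact mem_subwordComplexFacets _ _ _ _
  rw [h2, h1, sortingWord_longestElement, List.map_append, List.prod_append]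
  have h3 : linearCoxeterWord n = rowWord (n - 1) (n - 1) := by
    rw [rowWord, List.take_of_length_le (by simp)]
    rfl
  rw [h3, prod_rowWord le_rfl, ← prod_stairWord (le_refl (n - 1)), Nat.sub_self, nilStair, mul_one]

/-! ### The coefficient of the longest element in a staircase -/

/-- The product of the factors of the letters `j, …, j + d - 1`. -/
def nilSegment {A : Type*} [Ring A] [Algebra R A] (u : ℕ → A) (x : R) (j d : ℕ) : A :=
  ((List.range' j d).map (nilFactor u x)).prod

theorem nilSegment_succ {A : Type*} [Ring A] [Algebra R A] (u : ℕ → A) (x : R) (j d : ℕ) :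
    nilSegment u x j (d + 1) = nilFactor u x j * nilSegment u x (j + 1) d := by
  simp [nilSegment, List.range'_succ]

/-- Later letters cannot carry a value below them to `k`. -/
theorem nilSegment_apply_eq_zero {k : Fin n} {f : Perm (Fin n) → R}
    (hf : ∀ w, f w ≠ 0 → w k = k) (x : R) {j d : ℕ} (hjd : j + d = k) {w : Perm (Fin n)}
    (hw : (w k : ℕ) < j) : nilSegment (nilOp R n) x j d f w = 0 := by
  classical
  induction d generalizing j w with
  | zero =>
    by_contra h
    have := hf w h
    rw [this] at hw
    omega
  | succ d ih =>
    have hk := k.2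
    have h := nilFactor_nilOp_apply x (⟨j, by omega⟩ : Fin (n - 1))
      (nilSegment (nilOp R n) x (j + 1) d f) w
    rw [nilSegment_succ, Module.End.mul_apply, h, nilOp_apply, ih (by omega) (by omega),
      ih (w := adjacentTransposition n ⟨j, by omega⟩ * w) (by omega)]
    · simp
    · rw [Perm.mul_apply, adjacentTransposition_val]
      simp only
      split_ifs <;> omega

/-- If the value `j` stands in position `k`, then the letters `j, …, k - 1` must all be used, and
carry it to `k`. -/
theorem exists_nilSegment_apply_eq {k : Fin n} {f : Perm (Fin n) → R}
    (hf : ∀ w, f w ≠ 0 → w k = k) (x : R) {j d : ℕ} (hjd : j + d = k) {w : Perm (Fin n)}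
    (hw : (w k : ℕ) = j) (hfix : ∀ p, k < p → w p = p) :
    ∃ w' : Perm (Fin n), nilSegment (nilOp R n) x j d f w = x ^ d * f w' ∧
      (∀ p, k ≤ p → w' p = p) ∧ ∀ p q, p < k → q < k → (w' p < w' q ↔ w p < w q) := by
  classical
  induction d generalizing j w with
  | zero =>
    refine ⟨w, by simp [nilSegment], fun p hp => ?_, fun p q _ _ => Iff.rfl⟩
    rcases hp.lt_or_eq with hp | rfl
    · exact hfix p hp
    · exact Fin.ext (by omega)
  | succ d ih =>
    have hk := k.2
    set i : Fin (n - 1) := ⟨j, by omega⟩ with hi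
    have hwk : w k = loPoint i := Fin.ext hw
    have hdesc : IsLeftDescent w i := by
      have h1 : w⁻¹ (loPoint i) = k := by rw [← hwk, perm_inv_apply]
      rw [IsLeftDescent, h1]
      by_contra hcon
      rcases (not_lt.1 hcon).lt_or_eq with h2 | h2
      · have h3 := hfix _ h2
        rw [perm_apply_inv] at h3
        rw [← h3, Fin.lt_def] at h2
        simp only [hi] at h2
        omega
      · rw [h2, perm_apply_inv] at hwk
        exact (lo_lt_hi i).ne' hwk
    have hlo : ∀ p, p ≠ k → w p ≠ loPoint i := fun p hp h => hp (w.injective (h.trans hwk.symm))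
    obtain ⟨w', h1, h2, h3⟩ := ih (j := j + 1) (w := adjacentTransposition n i * w) (by omega)
      (by rw [Perm.mul_apply, hwk, adjacentTransposition_lo]) (fun p hp => by
        rw [Perm.mul_apply, hfix p hp]
        refine Fin.ext ?_
        rw [Fin.lt_def] at hp
        rw [adjacentTransposition_val]
        simp only [hi]
        split_ifs <;> omega)
    refine ⟨w', ?_, h2, fun p q hp hq => (h3 p q hp hq).trans ?_⟩
    · have h := nilFactor_nilOp_apply x i (nilSegment (nilOp R n) x (j + 1) d f) w
      rw [nilSegment_succ, Module.End.mul_apply, h, nilOp_apply, if_pos hdesc, h1,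
        nilSegment_apply_eq_zero hf x (by omega) (by omega), pow_succ']
      ring
    · exact adjacentTransposition_lt_iff i (fun h => hlo p hp.ne h.1) (fun h => hlo q hq.ne h.2)

/-- Letters that are not descents cannot be used. -/
theorem nilSegment_apply_of_not_isLeftDescent {f : Perm (Fin n) → R} (x : R) {w : Perm (Fin n)}
    {j e d : ℕ} (h : ∀ i : Fin (n - 1), j ≤ i → (i : ℕ) < j + e → ¬IsLeftDescent w i)
    (he : j + e ≤ n - 1) :
    nilSegment (nilOp R n) x j (e + d) f w = nilSegment (nilOp R n) x (j + e) d f w := by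
  classical
  induction e generalizing j with
  | zero => simp
  | succ e ih =>
    have h1 := nilFactor_nilOp_apply x (⟨j, by omega⟩ : Fin (n - 1))
      (nilSegment (nilOp R n) x (j + 1) (e + d) f) w
    rw [show e + 1 + d = e + d + 1 by omega, nilSegment_succ, Module.End.mul_apply, h1, nilOp_apply,
      if_neg (h _ le_rfl (by simp)), mul_zero, add_zero,
      ih (fun i h2 h3 => h i (by omega) (by omega)) (by omega),
      show j + 1 + e = j + (e + 1) by omega]

/-- `w` fixes all points above `k`, and its inversions among the points up to `k` are the pairs of
points of distinct regions. -/
def IsRegionReversingUpTo (J : Set (Fin (n - 1))) (k : ℕ) (w : Perm (Fin n)) : Prop :=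
  (∀ p : Fin n, k < p → w p = p) ∧
    ∀ p q : Fin n, p < q → (q : ℕ) ≤ k → (w q < w p ↔ (p : ℕ) < regionStart J q)

variable {J : Set (Fin (n - 1))}

theorem IsRegionReversingUpTo.apply_val {k : Fin n} {w : Perm (Fin n)}
    (hw : IsRegionReversingUpTo J k w) : (w k : ℕ) = k - regionStart J k := by
  have h1 : (Finset.Iio (w k)).card = (Finset.Ico (regionStart J k) k).card := by
    symm
    refine Finset.card_bij (fun p hp => w ⟨p, (Finset.mem_Ico.1 hp).2.trans k.2⟩) ?_ ?_ ?_
    · intro p hp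
      rw [Finset.mem_Ico] at hp
      rw [Finset.mem_Iio]
      have hne : (⟨p, hp.2.trans k.2⟩ : Fin n) ≠ k := fun h => hp.2.ne (congrArg Fin.val h)
      refine lt_of_le_of_ne (not_lt.1 fun h => ?_) (w.injective.ne hne)
      exact ((hw.2 _ k (Fin.lt_def.2 hp.2) le_rfl).1 h).not_ge hp.1
    · intro p hp q hq h
      exact congrArg Fin.val (w.injective h)
    · intro v hv
      rw [Finset.mem_Iio] at hv
      have hlt : w⁻¹ v < k := by
        by_contra hcon
        rcases (not_lt.1 hcon).lt_or_eq with h | h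
        · have h2 := hw.1 _ h
          rw [perm_apply_inv] at h2
          rw [← h2] at h
          have h3 := h.trans hv
          -- The values above `k` are fixed, so `w k` cannot exceed `k`.
          have h4 := hw.1 _ h3
          exact h3.ne (w.injective h4.symm)
        · rw [h, perm_apply_inv] at hv
          exact hv.false
      refine ⟨w⁻¹ v, Finset.mem_Ico.2 ⟨not_lt.1 fun h => ?_, hlt⟩, perm_apply_inv w v⟩
      have h2 := (hw.2 _ k hlt le_rfl).2 h
      rw [perm_apply_inv] at h2
      exact h2.asymm hv
  rw [Fin.card_Iio, Nat.card_Ico] at h1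
  exact h1

theorem IsRegionReversingUpTo.not_isLeftDescent {k : Fin n} {w : Perm (Fin n)}
    (hw : IsRegionReversingUpTo J k w) {i : Fin (n - 1)} (hi : (i : ℕ) < w k) :
    ¬IsLeftDescent w i := by
  intro h
  rw [IsLeftDescent] at h
  set p := w⁻¹ (loPoint i) with hp
  set q := w⁻¹ (hiPoint i) with hq
  have hwp : w p = loPoint i := perm_apply_inv _ _
  have hwq : w q = hiPoint i := perm_apply_inv _ _
  have hwk := hw.apply_val
  have hpk : p ≤ k := by
    by_contra hcon
    have h1 := hw.1 p (not_le.1 hcon)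
    rw [hwp] at h1
    rw [not_le, ← h1, Fin.lt_def] at hcon
    simp only at hcon
    omega
  have h1 := (hw.2 q p h hpk).1 (by rw [hwp, hwq]; exact lo_lt_hi i)
  have h2 : (q : ℕ) < regionStart J k := h1.trans_le (regionStart_mono J hpk)
  have h3 := (hw.2 q k (h.trans_le hpk) le_rfl).2 h2
  rw [hwq, Fin.lt_def] at h3
  simp only at h3
  omega

theorem nilRow_apply_ne_zero {k l : ℕ} (hkl : k ≤ l) (x : R) {f : Perm (Fin n) → R}
    (hf : ∀ w, f w ≠ 0 → ∀ p : Fin n, l < p → w p = p) (w : Perm (Fin n))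
    (hw : nilRow (nilOp R n) k x f w ≠ 0) (p : Fin n) (hp : l < p) : w p = p := by
  classical
  induction k generalizing f w with
  | zero => exact hf w hw p hp
  | succ k ih =>
    rw [nilRow_succ, Module.End.mul_apply] at hw
    refine ih (by omega) (f := nilFactor (nilOp R n) x k f) (fun v hv p hp => ?_) w hw
    have hpn := p.2
    have h := nilFactor_nilOp_apply x (⟨k, by omega⟩ : Fin (n - 1)) f v
    rw [nilOp_apply] at h
    simp only at h
    by_cases h0 : f v = 0
    · rw [h, h0] at hv
      split_ifs at hv with h1
      · have h2 := hf (adjacentTransposition n ⟨k, by omega⟩ * v)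
          (fun h3 => hv (by rw [h3, mul_zero, add_zero])) p hp
        rw [Perm.mul_apply] at h2
        have h4 := congrArg (adjacentTransposition n ⟨k, by omega⟩) h2
        rw [← Perm.mul_apply, adjacentTransposition_mul_self, Perm.one_apply] at h4
        rw [h4]
        refine Fin.ext ?_
        rw [adjacentTransposition_val]
        simp only
        split_ifs <;> omega
      · simp at hv
    · exact hf v h0 p hp

theorem nilStair_apply_ne_zero (y : ℕ → R) (k : ℕ) (w : Perm (Fin n))
    (hw : nilStair (nilOp R n) y k (Pi.single 1 1) w ≠ 0) (p : Fin n) (hp : k < p) : w p = p := by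
  induction k generalizing w p with
  | zero =>
    rw [nilStair, Module.End.one_apply] at hw
    have : w = 1 := by
      by_contra h
      exact hw (Pi.single_eq_of_ne h 1)
    rw [this, Perm.one_apply]
  | succ k ih =>
    rw [nilStair, Module.End.mul_apply] at hw
    exact nilRow_apply_ne_zero le_rfl _ (fun v hv p hp => ih v hv p (by omega)) w hw p hp

/-- The staircase has exactly one subword that is a reduced expression for the longest element of
the parabolic quotient: each row has to carry the value in position `k` to `k`, and it does so by
its last `regionStart J k` letters. -/
theorem nilStair_apply_isRegionReversingUpTo (y : ℕ → R) (k : ℕ) (hk : k ≤ n - 1)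
    (w : Perm (Fin n)) (hw : IsRegionReversingUpTo J k w) :
    nilStair (nilOp R n) y k (Pi.single 1 1) w =
      ∏ i ∈ Finset.range k, y (i + 1) ^ regionStart J (i + 1) := by
  induction k generalizing w with
  | zero =>
    have h1 : w = 1 := by
      ext p
      rcases Nat.eq_zero_or_pos p with h | h
      · have h2 : IsRegionReversingUpTo J p w := by rwa [h]
        rw [h2.apply_val, Perm.one_apply]
        omega
      · rw [hw.1 p h, Perm.one_apply]
    rw [h1, nilStair, Module.End.one_apply, Pi.single_eq_same, Finset.range_zero,
      Finset.prod_empty]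
  | succ k ih =>
    let K : Fin n := ⟨k + 1, by omega⟩
    have hw' : IsRegionReversingUpTo J K w := hw
    have hval := hw'.apply_val
    have hle := regionStart_le (J := J) (k + 1)
    have hf : ∀ v, nilStair (nilOp R n) y k (Pi.single 1 1) v ≠ 0 → v K = K :=
      fun v hv => nilStair_apply_ne_zero y k v hv K (Nat.lt_succ_self k)
    obtain ⟨w', h1, h2, h3⟩ := exists_nilSegment_apply_eq hf (y (k + 1)) (j := w K)
      (d := regionStart J (k + 1)) (by rw [hval]; exact Nat.sub_add_cancel hle) rfl hw.1
    have h4 : nilRow (nilOp R n) (k + 1) (y (k + 1)) =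
        nilSegment (nilOp R n) (y (k + 1)) 0 ((w K : ℕ) + regionStart J (k + 1)) := by
      rw [hval, nilRow, nilSegment, List.range_eq_range']
      congr 3
      exact (Nat.sub_add_cancel hle).symm
    rw [nilStair, Module.End.mul_apply, h4, nilSegment_apply_of_not_isLeftDescent, zero_add, h1,
      ih (by omega) w' ⟨fun p hp => h2 p hp, fun p q hpq hq => ?_⟩, Finset.prod_range_succ,
      mul_comm]
    · have hqK : q < K := Nat.lt_succ_of_le hq
      rw [h3 q p hqK (hpq.trans hqK)]
      exact hw.2 p q hpq (by omega)
    · intro i _ hi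
      exact hw'.not_isLeftDescent (by omega)
    · rw [zero_add, hval]
      simp only [K]
      omega

/-! ### Specialization of the weights -/

/-- The operators `A` and `B` correspond to each other under the change of coefficients `φ`. -/
def OpCompatible {S : Type*} [CommRing S] (φ : R →+* S) (A : Module.End R (Perm (Fin n) → R))
    (B : Module.End S (Perm (Fin n) → S)) : Prop :=
  ∀ f w, φ (A f w) = B (fun v => φ (f v)) w

section Specialization

variable {S : Type*} [CommRing S] {φ : R →+* S}

theorem OpCompatible.mul {A A' : Module.End R (Perm (Fin n) → R)}
    {B B' : Module.End S (Perm (Fin n) → S)} (h : OpCompatible φ A B)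
    (h' : OpCompatible φ A' B') : OpCompatible φ (A * A') (B * B') := by
  intro f w
  rw [Module.End.mul_apply, h, Module.End.mul_apply]
  exact congrArg (fun g => B g w) (funext fun v => h' f v)

theorem opCompatible_nilFactor (x : R) (k : ℕ) :
    OpCompatible φ (nilFactor (nilOp R n) x k) (nilFactor (nilOp S n) (φ x) k) := by
  classical
  intro f w
  rcases lt_or_ge k (n - 1) with h | h
  · lift k to Fin (n - 1) using h
    rw [nilFactor_nilOp_apply, nilFactor_nilOp_apply, nilOp_apply, nilOp_apply]
    split_ifs <;> simp
  · simp [nilFactor, nilOp_of_le h]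

theorem opCompatible_nilRow (x : R) (k : ℕ) :
    OpCompatible φ (nilRow (nilOp R n) k x) (nilRow (nilOp S n) k (φ x)) := by
  induction k with
  | zero => exact fun f w => rfl
  | succ k ih =>
    rw [nilRow_succ, nilRow_succ]
    exact ih.mul (opCompatible_nilFactor x k)

theorem opCompatible_nilStair (y : ℕ → R) (k : ℕ) :
    OpCompatible φ (nilStair (nilOp R n) y k) (nilStair (nilOp S n) (fun i => φ (y i)) k) := by
  induction k with
  | zero => exact fun f w => rfl
  | succ k ih => exact (opCompatible_nilRow _ _).mul ih

theorem map_chainWeight (a : ℕ → ℕ) (y : ℕ → R) (j m : ℕ) :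
    φ (chainWeight a y j m) = chainWeight a (fun i => φ (y i)) j m := by
  induction j generalizing m with
  | zero => simp [chainWeight]
  | succ j ih => simp [chainWeight, ih]

end Specialization

/-- The number of facets is the number of chains `m_0 ≤ m_1 ≤ ⋯ ≤ m_{n-1}` with
`m_i ≤ regionStart J i`, here counted according to the last entry. -/
theorem ncard_clusterComplexFacets_eq_sum (J : Set (Fin (n - 1))) :
    ((clusterComplexFacets (adjacentTransposition n) (linearCoxeterWord n) J).ncard : ℤ) =
      ∑ m ∈ Finset.range (regionStart J (n - 1) + 1),
        chainWeight (regionStart J) (fun _ => (1 : ℤ)) (n - 1) m := by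
  classical
  set w := longestElement (adjacentTransposition n) J with hw
  -- The weights are pairwise distinct perturbations of `1`.
  let y : ℕ → Polynomial ℤ := fun i => 1 + ((i : Polynomial ℤ) + 1) * Polynomial.X
  have hy : Function.Injective y := by
    intro i j hij
    have h := congrArg (Polynomial.eval 1) hij
    simpa [y] using h
  have hx : ∀ i ≤ n - 1, (1 : Polynomial ℤ) ≠ y i := by
    intro i _ h
    have h := congrArg (Polynomial.eval 1) h
    simp only [y, Polynomial.eval_add, Polynomial.eval_mul, Polynomial.eval_one,
      Polynomial.eval_natCast, Polynomial.eval_X] at h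
    omega
  let ψ : Module.End (Polynomial ℤ) (Perm (Fin n) → Polynomial ℤ) →ₗ[Polynomial ℤ]
      Polynomial ℤ :=
    LinearMap.proj w ∘ₗ LinearMap.applyₗ (Pi.single 1 1)
  have hwJ : IsRegionReversingUpTo J (n - 1) w :=
    ⟨fun p hp => absurd p.2 (by omega), fun p q hpq _ => isRegionReversing_longestElement J p q hpq⟩
  have h1 := functional_nilRow_mul_nilStair (isNilCoxeter_nilOp (R := Polynomial ℤ) (n := n))
    (regionStart J) (regionStart_mono J) regionStart_zero (n - 1) ψ 1 (fun y => by
      rw [one_mul]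
      exact nilStair_apply_isRegionReversingUpTo y (n - 1) le_rfl w hwJ) 1 y hy hx
  have h2 := congrArg (Polynomial.evalRingHom (0 : ℤ)) h1
  have h3 := ((opCompatible_nilRow (φ := Polynomial.evalRingHom (0 : ℤ)) (n := n) 1 (n - 1)).mul
    (opCompatible_nilStair y (n - 1))) (Pi.single 1 1) w
  have h4 : (fun v : Perm (Fin n) => Polynomial.evalRingHom (0 : ℤ)
      ((Pi.single 1 1 : Perm (Fin n) → Polynomial ℤ) v)) = Pi.single 1 1 := by
    funext v
    by_cases hv : v = 1
    · subst hv
      simp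
    · simp [hv]
  have h5 : ∀ i, Polynomial.evalRingHom (0 : ℤ) (y i) = 1 := fun i => by simp [y]
  rw [h4] at h3
  simp only [h5, map_one] at h3
  rw [ncard_clusterComplexFacets, ← hw, ← h3]
  refine Eq.trans h2 ?_
  simp only [map_sum, map_chainWeight, h5, one_pow, one_mul]

end Operators

/-! ### Chains -/

section Chains

open Classical in
/-- The chains `μ 0 ≤ μ 1 ≤ ⋯ ≤ μ (j - 1)` with `μ i ≤ a i` and `μ i ≤ b`. -/
noncomputable def boundedChains (a : ℕ → ℕ) (j b : ℕ) : Finset (Fin j → ℕ) :=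
  (Fintype.piFinset fun i : Fin j => Finset.range (a i + 1)).filter
    fun μ => Monotone μ ∧ ∀ i, μ i ≤ b

theorem mem_boundedChains {a : ℕ → ℕ} {j b : ℕ} {μ : Fin j → ℕ} :
    μ ∈ boundedChains a j b ↔ (∀ i, μ i ≤ a i) ∧ Monotone μ ∧ ∀ i, μ i ≤ b := by
  simp [boundedChains]

theorem card_boundedChains (a : ℕ → ℕ) (j b : ℕ) :
    ((boundedChains a j b).card : ℤ) = chainWeight a (fun _ => (1 : ℤ)) j b := by
  induction j generalizing b with
  | zero =>
    have : boundedChains a 0 b = Finset.univ := by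
      ext μ
      rw [mem_boundedChains]
      exact iff_of_true ⟨fun i => i.elim0, fun i => i.elim0, fun i => i.elim0⟩ (Finset.mem_univ _)
    rw [this]
    simp [chainWeight]
  | succ j ih =>
    have hmap : ∀ μ ∈ boundedChains a (j + 1) b,
        μ (Fin.last j) ∈ (Finset.range (a j + 1)).filter fun i => i ≤ b := by
      intro μ hμ
      rw [mem_boundedChains] at hμ
      rw [Finset.mem_filter, Finset.mem_range, Nat.lt_succ_iff]
      exact ⟨hμ.1 (Fin.last j), hμ.2.2 _⟩
    rw [Finset.card_eq_sum_card_fiberwise hmap, Nat.cast_sum, chainWeight]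
    refine Finset.sum_congr rfl fun m hm => ?_
    rw [Finset.mem_filter, Finset.mem_range, Nat.lt_succ_iff] at hm
    rw [one_pow, one_mul, ← ih, Nat.cast_inj]
    refine Finset.card_bij' (fun μ _ => Fin.init μ)
      (fun ν _ => Fin.snoc (α := fun _ => ℕ) ν m) ?_ ?_ ?_ ?_
    · intro μ hμ
      rw [Finset.mem_filter, mem_boundedChains] at hμ
      obtain ⟨⟨h1, h2, h3⟩, rfl⟩ := hμ
      rw [mem_boundedChains]
      exact ⟨fun i => h1 i.castSucc, fun i k hik => h2 (Fin.castSucc_le_castSucc_iff.2 hik),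
        fun i => h2 (Fin.le_last _)⟩
    · intro ν hν
      rw [mem_boundedChains] at hν
      obtain ⟨h1, h2, h3⟩ := hν
      rw [Finset.mem_filter, mem_boundedChains]
      refine ⟨⟨fun i => ?_, fun i k hik => ?_, fun i => ?_⟩, Fin.snoc_last _ _⟩
      · induction i using Fin.lastCases with
        | last => simpa using hm.1
        | cast i => simpa using h1 i
      · induction k using Fin.lastCases with
        | last =>
          induction i using Fin.lastCases with
          | last => exact le_rfl
          | cast i => simpa using h3 i
        | cast k =>
          induction i using Fin.lastCases with
          | last => exact absurd hik (not_le.2 (Fin.castSucc_lt_last k))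
          | cast i => simpa using h2 (Fin.castSucc_le_castSucc_iff.1 hik)
      · induction i using Fin.lastCases with
        | last => simpa using hm.2
        | cast i => simpa using (h3 i).trans hm.2
    · intro μ hμ
      rw [Finset.mem_filter] at hμ
      rw [← hμ.2]
      exact Fin.snoc_init_self μ
    · intro ν _
      exact Fin.init_snoc _ _

theorem sum_chainWeight_eq_card {a : ℕ → ℕ} (ha : Monotone a) {n : ℕ} (hn : 0 < n) :
    ∑ m ∈ Finset.range (a (n - 1) + 1), chainWeight a (fun _ => (1 : ℤ)) (n - 1) m =
      ({μ : Fin n → ℕ | (∀ i, μ i ≤ a i) ∧ Monotone μ}.ncard : ℤ) := by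
  obtain ⟨j, rfl⟩ : ∃ j, n = j + 1 := ⟨n - 1, by omega⟩
  have h1 : {μ : Fin (j + 1) → ℕ | (∀ i, μ i ≤ a i) ∧ Monotone μ} =
      boundedChains a (j + 1) (a j) := by
    ext μ
    rw [Finset.mem_coe, mem_boundedChains]
    exact ⟨fun h => ⟨h.1, h.2, fun i => (h.1 i).trans (ha (Nat.lt_succ_iff.1 i.2))⟩,
      fun h => ⟨h.1, h.2.1⟩⟩
  rw [h1, Set.ncard_coe_finset, card_boundedChains, chainWeight, Nat.add_sub_cancel,
    Finset.filter_true_of_mem fun i hi => Nat.lt_succ_iff.1 (Finset.mem_range.1 hi)]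
  simp

end Chains

/-! ### Nonnesting partitions -/

section Nonnesting

variable {n : ℕ} {P P' : Finpartition (Finset.univ : Finset (Fin n))}

theorem isBump_iff {a b : Fin n} :
    IsBump P a b ↔ a < b ∧ a ∈ P.part b ∧ ∀ x ∈ P.part b, ¬(a < x ∧ x < b) := by
  refine and_congr_right fun _ => ?_
  constructor
  · rintro ⟨B, hB, ha, hb, h⟩
    rw [P.part_eq_of_mem hB hb]
    exact ⟨ha, h⟩
  · rintro ⟨ha, h⟩
    exact ⟨P.part b, P.part_mem.2 (Finset.mem_univ b), ha, P.mem_part (Finset.mem_univ b), h⟩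

theorem mem_part_comm {a b : Fin n} : a ∈ P.part b ↔ b ∈ P.part a := by
  rw [P.mem_part_iff_part_eq_part (Finset.mem_univ _) (Finset.mem_univ _),
    P.mem_part_iff_part_eq_part (Finset.mem_univ _) (Finset.mem_univ _), eq_comm]

theorem mem_part_trans {a b c : Fin n} (h : a ∈ P.part b) (h' : b ∈ P.part c) :
    a ∈ P.part c := by
  rw [P.mem_part_iff_part_eq_part (Finset.mem_univ _) (Finset.mem_univ _)] at *
  exact h.trans h'

theorem IsBump.left_unique {a a' b : Fin n} (h : IsBump P a b) (h' : IsBump P a' b) :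
    a = a' := by
  rw [isBump_iff] at h h'
  rcases lt_trichotomy a a' with hlt | rfl | hlt
  · exact absurd ⟨hlt, h'.1⟩ (h.2.2 a' h'.2.1)
  · rfl
  · exact absurd ⟨hlt, h.1⟩ (h'.2.2 a h.2.1)

theorem IsBump.right_unique {a b b' : Fin n} (h : IsBump P a b) (h' : IsBump P a b') :
    b = b' := by
  rw [isBump_iff] at h h'
  have hb : b ∈ P.part b' := mem_part_trans (mem_part_comm.1 h.2.1) h'.2.1
  rcases lt_trichotomy b b' with hlt | rfl | hlt
  · exact absurd ⟨h.1, hlt⟩ (h'.2.2 b hb)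
  · rfl
  · exact absurd ⟨h'.1, hlt⟩ (h.2.2 b' (mem_part_comm.1 hb))

theorem exists_isBump_of_mem_part {a b : Fin n} (hab : a < b) (h : a ∈ P.part b) :
    ∃ c, a ≤ c ∧ a ∈ P.part c ∧ IsBump P c b := by
  classical
  set S := (P.part b).filter (· < b) with hS
  have ha : a ∈ S := Finset.mem_filter.2 ⟨h, hab⟩
  have hc := S.max'_mem ⟨a, ha⟩
  have hle := S.le_max' a ha
  have hmax := fun x hx => S.le_max' x hx
  set c := S.max' ⟨a, ha⟩
  rw [hS, Finset.mem_filter] at hc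
  refine ⟨c, hle, mem_part_trans h (mem_part_comm.1 hc.1), isBump_iff.2 ⟨hc.2, hc.1, ?_⟩⟩
  rintro x hx ⟨h1, h2⟩
  exact (hmax x (Finset.mem_filter.2 ⟨hx, h2⟩)).not_gt h1

theorem mem_part_of_isBump_imp (hP : ∀ a b, IsBump P a b → IsBump P' a b) {a b : Fin n}
    (hab : a ≤ b) (h : a ∈ P.part b) : a ∈ P'.part b := by
  induction b using WellFoundedLT.induction with
  | ind b ih =>
    rcases hab.lt_or_eq with hlt | rfl
    · obtain ⟨c, hac, hc, hb⟩ := exists_isBump_of_mem_part hlt h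
      exact mem_part_trans (ih c hb.1 hac hc) (isBump_iff.1 (hP c b hb)).2.1
    · exact P'.mem_part (Finset.mem_univ a)

theorem eq_of_part_eq (h : ∀ a, P.part a = P'.part a) : P = P' := by
  have key : ∀ Q Q' : Finpartition (Finset.univ : Finset (Fin n)),
      (∀ a, Q.part a = Q'.part a) → Q.parts ⊆ Q'.parts := by
    intro Q Q' h B hB
    obtain ⟨a, ha⟩ := Q.nonempty_of_mem_parts hB
    rw [← Q.part_eq_of_mem hB ha, h]
    exact Q'.part_mem.2 (Finset.mem_univ a)
  exact Finpartition.ext (Finset.Subset.antisymm (key P P' h) (key P' P fun a => (h a).symm))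

/-- A set partition is determined by its bumps. -/
theorem eq_of_isBump_iff (h : ∀ a b, IsBump P a b ↔ IsBump P' a b) : P = P' := by
  refine eq_of_part_eq fun b => ?_
  ext a
  have h1 : ∀ {a b}, a ≤ b → (a ∈ P.part b ↔ a ∈ P'.part b) := fun hab =>
    ⟨mem_part_of_isBump_imp (fun a b => (h a b).1) hab,
      mem_part_of_isBump_imp (fun a b => (h a b).2) hab⟩
  rcases le_total a b with hab | hab
  · exact h1 hab
  · rw [mem_part_comm, h1 hab, mem_part_comm]

/-- A relation whose edges increase, and in which each point has at most one predecessor and at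
most one successor, is the set of bumps of a set partition. -/
theorem exists_finpartition_isBump_iff (E : Fin n → Fin n → Prop) (hlt : ∀ a b, E a b → a < b)
    (hleft : ∀ a a' b, E a b → E a' b → a = a') (hright : ∀ a b b', E a b → E a b' → b = b') :
    ∃ P : Finpartition (Finset.univ : Finset (Fin n)), ∀ a b, IsBump P a b ↔ E a b := by
  classical
  have hle : ∀ {a b}, Relation.ReflTransGen E a b → a ≤ b := by
    intro a b h
    induction h with
    | refl => exact le_rfl
    | tail _ h ih => exact ih.trans (hlt _ _ h).le
  have hsource : ∀ {a b c}, Relation.ReflTransGen E a c → Relation.ReflTransGen E b c →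
      Relation.ReflTransGen E a b ∨ Relation.ReflTransGen E b a := by
    intro a b c h1 h2
    have := Relation.ReflTransGen.total_of_right_unique (r := Function.swap E)
      (fun x y z h h' => hleft _ _ _ h h') (Relation.reflTransGen_swap.2 h1)
      (Relation.reflTransGen_swap.2 h2)
    exact this.symm.imp Relation.reflTransGen_swap.1 Relation.reflTransGen_swap.1
  have htarget : ∀ {a b c}, Relation.ReflTransGen E a b → Relation.ReflTransGen E a c →
      Relation.ReflTransGen E b c ∨ Relation.ReflTransGen E c b := fun h1 h2 =>
    Relation.ReflTransGen.total_of_right_unique (fun x y z h h' => hright _ _ _ h h') h1 h2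
  -- The parts are the maximal paths of `E`.
  let s : Setoid (Fin n) :=
    { r := fun a b => Relation.ReflTransGen E a b ∨ Relation.ReflTransGen E b a
      iseqv :=
        { refl := fun a => Or.inl .refl
          symm := fun h => h.symm
          trans := by
            rintro a b c (h1 | h1) (h2 | h2)
            · exact Or.inl (h1.trans h2)
            · exact hsource h1 h2
            · exact htarget h1 h2
            · exact Or.inr (h2.trans h1) } }
  have hreach : ∀ {a b}, a ≤ b → s a b → Relation.ReflTransGen E a b := by
    rintro a b hab (h | h)
    · exact h
    · rw [le_antisymm hab (hle h)]
  refine ⟨Finpartition.ofSetoid s, fun a b => ?_⟩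
  have hmem : ∀ x, x ∈ (Finpartition.ofSetoid s).part b ↔ s x b := fun x => by
    rw [Finpartition.mem_part_ofSetoid_iff_rel]
    exact ⟨fun h => s.symm h, fun h => s.symm h⟩
  simp only [isBump_iff, hmem]
  constructor
  · rintro ⟨hab, h, hno⟩
    rcases (hreach hab.le h).cases_tail with rfl | ⟨c, hac, hcb⟩
    · exact absurd hab (lt_irrefl _)
    · rcases (hle hac).lt_or_eq with h1 | rfl
      · exact absurd ⟨h1, hlt c b hcb⟩ (hno c (Or.inl (.single hcb)))
      · exact hcb
  · intro h
    refine ⟨hlt a b h, Or.inl (.single h), ?_⟩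
    rintro x hx ⟨h1, h2⟩
    rcases (hreach h2.le hx).cases_tail with rfl | ⟨c, hxc, hcb⟩
    · exact lt_irrefl _ h2
    · rw [hleft c a b hcb h] at hxc
      exact (hle hxc).not_gt h1

variable {J : Set (Fin (n - 1))}

open Classical in
/-- The largest left end, plus one, of a bump of `P` whose right end is at most `k`; zero if there
is no such bump. The interval from `p` to `k` contains a bump if and only if `p` is less than this
number, so that it records the `k`-th row of the order filter generated by the bumps. -/
noncomputable def bumpHeight (P : Finpartition (Finset.univ : Finset (Fin n))) (k : Fin n) : ℕ :=
  (Finset.univ.filter fun i : Fin n => ∃ j ≤ k, IsBump P i j).sup fun i => (i : ℕ) + 1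

theorem lt_bumpHeight_iff {p : ℕ} {k : Fin n} :
    p < bumpHeight P k ↔ ∃ i j, j ≤ k ∧ IsBump P i j ∧ p ≤ i := by
  classical
  simp only [bumpHeight, Finset.lt_sup_iff, Finset.mem_filter, Finset.mem_univ, true_and,
    Nat.lt_succ_iff]
  exact ⟨fun ⟨i, ⟨j, h1, h2⟩, h3⟩ => ⟨i, j, h1, h2, h3⟩,
    fun ⟨i, j, h1, h2, h3⟩ => ⟨i, ⟨j, h1, h2⟩, h3⟩⟩

theorem bumpHeight_mono (P : Finpartition (Finset.univ : Finset (Fin n))) :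
    Monotone (bumpHeight P) := by
  intro k l hkl
  refine le_of_forall_lt fun p hp => ?_
  obtain ⟨i, j, h1, h2, h3⟩ := lt_bumpHeight_iff.1 hp
  exact lt_bumpHeight_iff.2 ⟨i, j, h1.trans hkl, h2, h3⟩

theorem lt_regionStart_of_isBump (hP : P ∈ nonnestingPartitions J) {i j : Fin n}
    (h : IsBump P i j) : (i : ℕ) < regionStart J j := by
  by_contra hcon
  have hs := (sameRegion_iff (J := J) h.1.le).2 (not_lt.1 hcon)
  obtain ⟨hij, B, hB, hi, hj, -⟩ := h
  exact hP.1 i j hij.ne hs ⟨B, hB, hi, hj⟩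

theorem bumpHeight_le_regionStart (hP : P ∈ nonnestingPartitions J) (k : Fin n) :
    bumpHeight P k ≤ regionStart J k := by
  refine le_of_forall_lt fun p hp => ?_
  obtain ⟨i, j, h1, h2, h3⟩ := lt_bumpHeight_iff.1 hp
  exact (h3.trans_lt (lt_regionStart_of_isBump hP h2)).trans_le (regionStart_mono J h1)

/-- `μ` takes the value `i + 1` at `k` for the first time, having been at most `i` before. If
`μ = bumpHeight P` with `P` nonnesting, these pairs are the bumps of `P`. -/
def IsJump (μ : Fin n → ℕ) (i k : Fin n) : Prop :=
  μ k = i + 1 ∧ ∀ j < k, μ j ≤ i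

theorem isBump_iff_isJump (hP : P ∈ nonnestingPartitions J) {i k : Fin n} :
    IsBump P i k ↔ IsJump (bumpHeight P) i k := by
  constructor
  · intro h
    have hlow : ∀ j < k, bumpHeight P j ≤ i := by
      intro j hj
      by_contra hcon
      obtain ⟨i', j', h1, h2, h3⟩ := lt_bumpHeight_iff.1 (not_le.1 hcon)
      have hjk : j' < k := h1.trans_lt hj
      rcases (Fin.le_def.2 h3).lt_or_eq with h4 | rfl
      · exact hP.2 i k i' j' h h2 ⟨h4, h2.1, hjk⟩
      · exact hjk.ne (h2.right_unique h)
    refine ⟨le_antisymm ?_ (lt_bumpHeight_iff.2 ⟨i, k, le_rfl, h, le_rfl⟩), hlow⟩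
    by_contra hcon
    obtain ⟨i', j', h1, h2, h3⟩ := lt_bumpHeight_iff.1 (not_le.1 hcon)
    rcases h1.lt_or_eq with h4 | rfl
    · have h5 := hlow j' h4
      have h6 : (i' : ℕ) < bumpHeight P j' := lt_bumpHeight_iff.2 ⟨i', j', le_rfl, h2, le_rfl⟩
      omega
    · rw [h2.left_unique h] at h3
      omega
  · rintro ⟨h1, h2⟩
    obtain ⟨i', j, h3, h4, h5⟩ := lt_bumpHeight_iff.1 (show (i : ℕ) < bumpHeight P k by omega)
    have h6 : (i' : ℕ) < bumpHeight P j := lt_bumpHeight_iff.2 ⟨i', j, le_rfl, h4, le_rfl⟩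
    rcases h3.lt_or_eq with h7 | rfl
    · have := h2 j h7
      omega
    · have : i' = i := Fin.ext (by omega)
      rwa [← this]

theorem exists_nonnestingPartition_bumpHeight_eq {μ : Fin n → ℕ}
    (hμ : ∀ i : Fin n, μ i ≤ regionStart J i) (hmono : Monotone μ) :
    ∃ P ∈ nonnestingPartitions J, bumpHeight P = μ := by
  have hreg : ∀ {i k}, IsJump μ i k → (i : ℕ) < regionStart J k := fun {i k} h => by
    have h1 := hμ k
    have h2 := h.1
    omega
  obtain ⟨P, hP⟩ := exists_finpartition_isBump_iff (IsJump μ)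
    (fun i k h => Fin.lt_def.2 ((hreg h).trans_le (regionStart_le _)))
    (fun i i' k h h' => Fin.ext (by have := h.1; have := h'.1; omega))
    (fun i k k' h h' => by
      rcases lt_trichotomy k k' with h1 | h1 | h1
      · have := h'.2 k h1
        have := h.1
        omega
      · exact h1
      · have := h.2 k' h1
        have := h'.1
        omega)
  refine ⟨P, ⟨?_, ?_⟩, ?_⟩
  · have key : ∀ i j : Fin n, i < j → SameRegion J i j → i ∉ P.part j := by
      intro i j hij hs hmem
      obtain ⟨c, hic, -, hc⟩ := exists_isBump_of_mem_part hij hmem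
      have h1 := hreg ((hP c j).1 hc)
      have h2 := (sameRegion_iff hij.le).1 hs
      rw [Fin.le_def] at hic
      omega
    rintro i j hij hs ⟨B, hB, hi, hj⟩
    rcases lt_or_gt_of_ne hij with h | h
    · exact key i j h hs (by rwa [P.part_eq_of_mem hB hj])
    · refine key j i h ?_ (by rwa [P.part_eq_of_mem hB hi])
      intro k h1 h2
      exact hs k (by rwa [min_comm]) (by rwa [max_comm])
  · rintro i₁ i₂ j₁ j₂ hi hj ⟨h1, -, h3⟩
    have h4 := ((hP _ _).1 hi).2 j₂ h3
    have h5 := ((hP _ _).1 hj).1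
    rw [Fin.lt_def] at h1
    omega
  · funext k
    refine le_antisymm (le_of_forall_lt fun p hp => ?_) (le_of_forall_lt fun p hp => ?_)
    · obtain ⟨i, j, h1, h2, h3⟩ := lt_bumpHeight_iff.1 hp
      have h4 := ((hP i j).1 h2).1
      have h5 := hmono h1
      omega
    · -- The first point at which `μ` takes the value `μ k` is the right end of a bump.
      classical
      set S := Finset.univ.filter fun j : Fin n => μ j = μ k with hS
      have hk : k ∈ S := by simp [hS]
      have hj := S.min'_mem ⟨k, hk⟩
      have hjk := S.min'_le k hk
      have hmin := fun x hx => S.min'_le x hx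
      set j := S.min' ⟨k, hk⟩
      rw [hS, Finset.mem_filter] at hj
      have hle := (hμ k).trans (regionStart_le (J := J) (k : ℕ))
      have hkn := k.2
      refine lt_bumpHeight_iff.2 ⟨⟨μ k - 1, by omega⟩, j, hjk, (hP _ _).2 ⟨?_, ?_⟩, ?_⟩
      · rw [hj.2]
        simp only
        omega
      · intro l hl
        have h1 := hmono (hl.le.trans hjk)
        have h2 : μ l ≠ μ k := fun h => (hmin l (by simp [hS, h])).not_gt hl
        simp only
        omega
      · simp only
        omega

theorem ncard_nonnestingPartitions (J : Set (Fin (n - 1))) :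
    (nonnestingPartitions J).ncard =
      {μ : Fin n → ℕ | (∀ i : Fin n, μ i ≤ regionStart J i) ∧ Monotone μ}.ncard := by
  refine Set.ncard_congr (fun P _ => bumpHeight P)
    (fun P hP => ⟨bumpHeight_le_regionStart hP, bumpHeight_mono P⟩) ?_ ?_
  · intro P P' hP hP' h
    refine eq_of_isBump_iff fun a b => ?_
    rw [isBump_iff_isJump hP, isBump_iff_isJump hP', h]
  · rintro μ ⟨h1, h2⟩
    obtain ⟨P, hP, h⟩ := exists_nonnestingPartition_bumpHeight_eq h1 h2
    exact ⟨P, hP, h⟩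

end Nonnesting

theorem mainTheorem3 (n : ℕ) (hn : 0 < n) (J : Set (Fin (n - 1))) :
    (clusterComplexFacets (adjacentTransposition n) (linearCoxeterWord n) J).ncard =
      (nonnestingPartitions J).ncard := by
  rw [← Nat.cast_inj (R := ℤ), ncard_clusterComplexFacets_eq_sum,
    sum_chainWeight_eq_card (regionStart_mono J) hn, ncard_nonnestingPartitions]
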